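/- Let $p$ be a probability distribution on an input space $U$, let $X=\{X_1,\dots,X_K\}$ be real readout functions on $U$ and $y$ a real target function on $U$, with $E[\,\cdot\,]$ denoting expectation under $p$. Assume that $E[|X_i|^5]<\infty$ for all $i$, $E[|y|^5]<\infty$ and $E[y^2]>0$. Define the capacity $$C(y,X)=1-\frac{\min_{W\in\mathbb R^K}E\big[(\sum_i W_iX_i-y)^2\big]}{E[y^2]} .$$ Let $u(1),u(2),\dots$ be i.i.d. samples from $p$. From the first $N$ of them form $(G_N)_{ij}=\frac1N\sum_{n=1}^N X_i(u(n))X_j(u(n))$ and $(R_N)_i=\frac1N\sum_{n=1}^N X_i(u(n))\,y(u(n))$, and let $$C_N(y,X)=\frac{R_N^{T}G_N^{+}R_N}{E[y^2]}$$ be the empirical capacity, where $E[y^2]$ is taken to be known exactly and $G_N^{+}$ is the Moore–Penrose pseudo-inverse ($G_N^{+}=G_N^{-1}$ when $G_N$ is invertible). Let $\mathcal X=\mathrm{span}\{X_1,\dots,X_K\}\subset L^2(p)$, let $P^\perp_{\mathcal X}$ be the orthogonal projector of $L^2(p)$ onto the orthogonal complement of $\mathcal X$, and let $\tilde X_1,\dots,\tilde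 X_d$ be any orthonormal basis of $\mathcal X$ (so $d=K$ when the Gram matrix $(E[X_iX_j])_{ij}$ is invertible). Put $$\Delta(y,X)=\frac{E\Big[\big(\sum_{i=1}^d\tilde X_i^2\big)\,\big(P^\perp_{\mathcal X}y\big)^2\Big]}{E[y^2]} .$$ Then $C_N(y,X)$ is integrable for every $N$, the expectation defining $\Delta(y,X)$ is finite, $\Delta(y,X)\ge 0$, and, as $N\to\infty$ with $p$, $X$ and $y$ fixed, the expectation of $C_N(y,X)$ over datasets satisfies $$E\big[C_N(y,X)\big]=C(y,X)+\frac{\Delta(y,X)}{N}+\mathcal O\big(N^{-3/2}\big).$$ -/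

import Mathlib

open MeasureTheory ProbabilityTheory Filter
open scoped Matrix

namespace IPC

/-! ## Moore–Penrose pseudo-inverse of a real square matrix -/

/-- `B` is the Moore–Penrose pseudo-inverse of `A`. -/
structure IsMoorePenrose {n : Type*} [Fintype n] (A B : Matrix n n ℝ) : Prop where
  mul_mul_left : A * B * A = A
  mul_mul_right : B * A * B = B
  isSymm_left : (A * B)ᵀ = A * B
  isSymm_right : (B * A)ᵀ = B * A

theorem IsMoorePenrose.unique {n : Type*} [Fintype n] {A B C : Matrix n n ℝ}
    (hB : IsMoorePenrose A B) (hC : IsMoorePenrose A C) : B = C := by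
  have h1 : A * B = A * C := by
    calc A * B = (A * B)ᵀ := hB.isSymm_left.symm
      _ = (A * C * (A * B))ᵀ := by rw [← mul_assoc (A * C) A B, hC.mul_mul_left]
      _ = A * B * (A * C) := by rw [Matrix.transpose_mul, hB.isSymm_left, hC.isSymm_left]
      _ = A * C := by rw [← mul_assoc (A * B) A C, hB.mul_mul_left]
  have h2 : B * A = C * A := by
    calc B * A = (B * A)ᵀ := hB.isSymm_right.symm
      _ = (B * A * (C * A))ᵀ := by rw [mul_assoc B A (C * A), ← mul_assoc A C A, hC.mul_mul_left]
      _ = C * A * (B * A) := by rw [Matrix.transpose_mul, hB.isSymm_right, hC.isSymm_right]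
      _ = C * A := by rw [mul_assoc C A (B * A), ← mul_assoc A B A, hB.mul_mul_left]
  calc B = B * A * B := hB.mul_mul_right.symm
    _ = C * A * C := by rw [h2, mul_assoc, h1, ← mul_assoc]
    _ = C := hC.mul_mul_right

theorem exists_isMoorePenrose {n : Type*} [Fintype n] {A : Matrix n n ℝ} (hA : Aᵀ = A) :
    ∃ B, IsMoorePenrose A B := by
  classical
  have hH : A.IsHermitian := by
    rw [Matrix.IsHermitian, Matrix.conjTranspose_eq_transpose_of_trivial, hA]
  obtain ⟨V, d, hV, hAV⟩ : ∃ (V : Matrix n n ℝ) (d : n → ℝ),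
      Vᵀ * V = 1 ∧ A = V * Matrix.diagonal d * Vᵀ := by
    refine ⟨hH.eigenvectorUnitary, hH.eigenvalues, ?_, ?_⟩
    · have := Unitary.coe_star_mul_self hH.eigenvectorUnitary
      rwa [Matrix.star_eq_conjTranspose, Matrix.conjTranspose_eq_transpose_of_trivial] at this
    · have := hH.spectral_theorem
      rw [Unitary.conjStarAlgAut_apply, Matrix.star_eq_conjTranspose,
        Matrix.conjTranspose_eq_transpose_of_trivial] at this
      exact this
  have key : ∀ a b : n → ℝ, V * Matrix.diagonal a * Vᵀ * (V * Matrix.diagonal b * Vᵀ)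
      = V * Matrix.diagonal (fun i => a i * b i) * Vᵀ := by
    intro a b
    calc _ = V * Matrix.diagonal a * (Vᵀ * V) * Matrix.diagonal b * Vᵀ := by
          simp only [mul_assoc]
      _ = _ := by rw [hV, mul_one, mul_assoc V, Matrix.diagonal_mul_diagonal]
  have hT : ∀ a : n → ℝ, (V * Matrix.diagonal a * Vᵀ)ᵀ = V * Matrix.diagonal a * Vᵀ := by
    intro a
    simp [Matrix.transpose_mul, mul_assoc]
  refine ⟨V * Matrix.diagonal (fun i => (d i)⁻¹) * Vᵀ, ?_, ?_, ?_, ?_⟩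
  · rw [hAV, key, key]
    congr 3; ext i; exact mul_inv_mul_cancel (d i)
  · rw [hAV, key, key]
    congr 3; ext i; simpa using mul_inv_mul_cancel (d i)⁻¹
  · rw [hAV, key, hT]
  · rw [hAV, key, hT]

open Classical in
/-- The Moore–Penrose pseudo-inverse (it is used here for symmetric matrices only). -/
noncomputable def pinv {n : Type*} [Fintype n] (A : Matrix n n ℝ) : Matrix n n ℝ :=
  if h : ∃ B, IsMoorePenrose A B then h.choose else 0

theorem isMoorePenrose_pinv {n : Type*} [Fintype n] {A : Matrix n n ℝ} (hA : Aᵀ = A) :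
    IsMoorePenrose A (pinv A) := by
  have h := exists_isMoorePenrose hA
  rw [pinv, dif_pos h]
  exact h.choose_spec

/-! ## Capacity with respect to the input distribution -/

section Population

variable {U : Type*} [MeasurableSpace U] {K : ℕ}

/-- Gram matrix `G i j = E[X i * X j]`. -/
noncomputable def gram (p : Measure U) (X : Fin K → U → ℝ) : Matrix (Fin K) (Fin K) ℝ :=
  Matrix.of fun i j => ∫ v, X i v * X j v ∂p

/-- Correlation vector `R i = E[X i * y]`. -/
noncomputable def corr (p : Measure U) (X : Fin K → U → ℝ) (y : U → ℝ) : Fin K → ℝ :=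
  fun i => ∫ v, X i v * y v ∂p

/-- Mean squared error `E[(∑ i, W i * X i - y)^2]` of the output with weights `W`. -/
noncomputable def mse (p : Measure U) (X : Fin K → U → ℝ) (y : U → ℝ) (W : Fin K → ℝ) : ℝ :=
  ∫ v, (∑ i, W i * X i v - y v) ^ 2 ∂p

/-- The capacity `1 - MSE⋆ / E[y^2]`, where `MSE⋆` is the smallest mean squared error. -/
noncomputable def capacity (p : Measure U) (X : Fin K → U → ℝ) (y : U → ℝ) : ℝ :=
  1 - (⨅ W : Fin K → ℝ, mse p X y W) / ∫ v, y v ^ 2 ∂p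

/-- The span of the readouts, as a subspace of `L²(p)`. -/
noncomputable def readoutSpace (p : Measure U) (X : Fin K → U → ℝ) (hX : ∀ i, MemLp (X i) 2 p) :
    Submodule ℝ (Lp ℝ 2 p) :=
  Submodule.span ℝ (Set.range fun i => (hX i).toLp (X i))

instance (p : Measure U) (X : Fin K → U → ℝ) (hX : ∀ i, MemLp (X i) 2 p) :
    FiniteDimensional ℝ (readoutSpace p X hX) :=
  FiniteDimensional.span_of_finite ℝ (Set.finite_range _)

/-- The component of `y` orthogonal to the span of the readouts, in `L²(p)`. -/
noncomputable def orthComponent (p : Measure U) (X : Fin K → U → ℝ) (y : U → ℝ)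
    (hX : ∀ i, MemLp (X i) 2 p) (hy : MemLp y 2 p) : Lp ℝ 2 p :=
  (readoutSpace p X hX)ᗮ.starProjection (hy.toLp y)

/-- The integrand `(∑ i, X̃ i ^ 2) * (P⊥ y) ^ 2`, where `X̃` is an orthonormal basis of the span of
the readouts. -/
noncomputable def biasIntegrand (p : Measure U) (X : Fin K → U → ℝ) (y : U → ℝ)
    (hX : ∀ i, MemLp (X i) 2 p) (hy : MemLp y 2 p) {ι : Type*} [Fintype ι]
    (Xt : OrthonormalBasis ι ℝ (readoutSpace p X hX)) (v : U) : ℝ :=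
  (∑ i, ((Xt i : Lp ℝ 2 p) : U → ℝ) v ^ 2) * (orthComponent p X y hX hy : U → ℝ) v ^ 2

/-- The coefficient `Δ(y, X)` of the `1 / N` bias. -/
noncomputable def biasCoeff (p : Measure U) (X : Fin K → U → ℝ) (y : U → ℝ)
    (hX : ∀ i, MemLp (X i) 2 p) (hy : MemLp y 2 p) {ι : Type*} [Fintype ι]
    (Xt : OrthonormalBasis ι ℝ (readoutSpace p X hX)) : ℝ :=
  (∫ v, biasIntegrand p X y hX hy Xt v ∂p) / ∫ v, y v ^ 2 ∂p

end Population

/-! ## Capacity estimated from `N` samples -/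

section Empirical

variable {U : Type*} [MeasurableSpace U] {K N : ℕ}

/-- Empirical Gram matrix of the samples `s 0, …, s (N - 1)`. -/
noncomputable def empGram (X : Fin K → U → ℝ) (s : Fin N → U) : Matrix (Fin K) (Fin K) ℝ :=
  Matrix.of fun i j => (N : ℝ)⁻¹ * ∑ n, X i (s n) * X j (s n)

/-- Empirical correlation vector. -/
noncomputable def empCorr (X : Fin K → U → ℝ) (y : U → ℝ) (s : Fin N → U) : Fin K → ℝ :=
  fun i => (N : ℝ)⁻¹ * ∑ n, X i (s n) * y (s n)

/-- Empirical capacity `R_Nᵀ G_N⁺ R_N / E[y^2]`; the normalization `E[y^2]` is the exact one. -/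
noncomputable def empCapacity (p : Measure U) (X : Fin K → U → ℝ) (y : U → ℝ)
    (s : Fin N → U) : ℝ :=
  (empCorr X y s ⬝ᵥ (pinv (empGram X s) *ᵥ empCorr X y s)) / ∫ v, y v ^ 2 ∂p

end Empirical

end IPC

/- Replacing the readouts by an orthonormal basis `x` of their span, and the target by its component
`z` orthogonal to that span, changes `E[y ^ 2] * C_N` only by a difference of two empirical means,
whose expectation is explicit. What is left is `r ⬝ᵥ v`, where `G *ᵥ v = r` for the empirical Gram
matrix `G` of the `x i` and their empirical correlations `r` with `z`. Since `G` fluctuates around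
`1` and `r` around `0`, it differs from `r ⬝ᵥ r` by a term of third order in the deviations, while
`r ⬝ᵥ r` has expectation `∑ i, E[(x i * z) ^ 2] / N`, which is the bias.

The products `x i * x j`, `x i * z` and `z ^ 2` only lie in `L^(5/2)`, so they need not have third
moments. They are truncated at the level `N`: Rosenthal's inequality with exponent `3` bounds the
third moment of the truncated deviations by a multiple of `N ^ (-3 / 2)`, and the mean of the part
cut off has the same order. A sample on which anything is cut off has an empirical mean of the
cut-off parts of at least `1`, so the bounds on such samples are absorbed by the expectation of that
mean. -/

namespace IPC

section Rosenthal

theorem abs_add_pow_three_le (a b : ℝ) :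
    |a + b| ^ 3 ≤ |a| ^ 3 + 3 * (a * |a|) * b + 3 * |a| * b ^ 2 + |b| ^ 3 := by
  wlog ha : 0 ≤ a generalizing a b
  · have hneg := this (-a) (-b) (by linarith)
    rw [← neg_add, abs_neg, abs_neg, abs_neg] at hneg
    linarith
  have hquad : 0 ≤ a * (a ^ 2 + 3 * (a * b) + 3 * b ^ 2) :=
    mul_nonneg ha (by nlinarith [sq_nonneg (2 * a + 3 * b), sq_nonneg b])
  rw [abs_of_nonneg ha]
  rcases le_total 0 b with hb | hb
  · rw [abs_of_nonneg hb, abs_of_nonneg (add_nonneg ha hb)]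
    exact le_of_eq (by ring)
  have hcube : 0 ≤ (-b) ^ 3 := pow_nonneg (neg_nonneg.2 hb) 3
  rw [abs_of_nonpos hb]
  rcases abs_cases (a + b) with ⟨h, -⟩ | ⟨h, -⟩ <;> rw [h] <;> nlinarith

variable {Ω : Type*} [MeasurableSpace Ω] {P : Measure Ω} [IsProbabilityMeasure P]

theorem integral_abs_le_sqrt_integral_sq {f : Ω → ℝ} (hf : MemLp f 2 P) :
    ∫ ω, |f ω| ∂P ≤ √(∫ ω, f ω ^ 2 ∂P) := by
  refine Real.le_sqrt_of_sq_le ?_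
  have hvar := variance_nonneg |f| P
  rw [variance_eq_sub hf.abs] at hvar
  simpa [sq_abs] using hvar

theorem integral_abs_add_pow_three_le {S Y : Ω → ℝ} (hSY : IndepFun S Y P) (hS : MemLp S 3 P)
    (hY : MemLp Y 3 P) (hY0 : ∫ ω, Y ω ∂P = 0) :
    ∫ ω, |S ω + Y ω| ^ 3 ∂P ≤ ∫ ω, |S ω| ^ 3 ∂P
      + 3 * ((∫ ω, |S ω| ∂P) * ∫ ω, Y ω ^ 2 ∂P) + ∫ ω, |Y ω| ^ 3 ∂P := by
  have hS1 : Integrable S P := hS.integrable (by norm_num)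
  have hY1 : Integrable Y P := hY.integrable (by norm_num)
  have hS2 : Integrable (fun ω => S ω * |S ω|) P :=
    (hS.mono_exponent (by norm_num : (2 : ENNReal) ≤ 3)).integrable_mul
      (hS.mono_exponent (by norm_num : (2 : ENNReal) ≤ 3)).abs
  have hY2 : Integrable (fun ω => Y ω ^ 2) P :=
    (hY.mono_exponent (by norm_num : (2 : ENNReal) ≤ 3)).integrable_sq
  have hlin : IndepFun (fun ω => S ω * |S ω|) Y P :=
    hSY.comp (φ := fun t => t * |t|) (ψ := id) (by fun_prop) measurable_id
  have hquad : IndepFun (fun ω => |S ω|) (fun ω => Y ω ^ 2) P :=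
    hSY.comp (φ := fun t => |t|) (ψ := fun t => t ^ 2) (by fun_prop) (by fun_prop)
  have hlin_int : Integrable (fun ω => 3 * (S ω * |S ω| * Y ω)) P :=
    (hlin.integrable_mul hS2 hY1).const_mul 3
  have hquad_int : Integrable (fun ω => 3 * (|S ω| * Y ω ^ 2)) P :=
    (hquad.integrable_mul hS1.abs hY2).const_mul 3
  have hS3 : Integrable (fun ω => |S ω| ^ 3) P := hS.integrable_norm_pow (by norm_num)
  have hY3 : Integrable (fun ω => |Y ω| ^ 3) P := hY.integrable_norm_pow (by norm_num)
  have hSlin : Integrable (fun ω => |S ω| ^ 3 + 3 * (S ω * |S ω| * Y ω)) P := hS3.add hlin_int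
  calc ∫ ω, |S ω + Y ω| ^ 3 ∂P
      ≤ ∫ ω, (|S ω| ^ 3 + 3 * (S ω * |S ω| * Y ω) + 3 * (|S ω| * Y ω ^ 2) + |Y ω| ^ 3) ∂P :=
        integral_mono ((hS.add hY).integrable_norm_pow (by norm_num))
          ((hSlin.add hquad_int).add hY3)
          fun ω => (abs_add_pow_three_le _ _).trans_eq (by ring)
    _ = _ := by
        rw [integral_add ?_ hY3, integral_add hSlin hquad_int,
          integral_add hS3 hlin_int, integral_const_mul, integral_const_mul,
          hlin.integral_fun_mul_eq_mul_integral hS2.1 hY1.1,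
          hquad.integral_fun_mul_eq_mul_integral hS1.abs.1 hY2.1, hY0]
        · ring
        · exact hSlin.add hquad_int

theorem integral_abs_add_const_pow_three_le {f : Ω → ℝ} (hf : MemLp f 3 P) (c : ℝ) :
    ∫ ω, |f ω + c| ^ 3 ∂P ≤ 4 * (∫ ω, |f ω| ^ 3 ∂P + |c| ^ 3) := by
  have hf3 : Integrable (fun ω => |f ω| ^ 3) P := hf.integrable_norm_pow (by norm_num)
  have hpoint : ∀ ω, |f ω + c| ^ 3 ≤ 4 * (|f ω| ^ 3 + |c| ^ 3) := fun ω =>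
    ((pow_le_pow_left₀ (abs_nonneg _) (abs_add_le (f ω) c) 3).trans
      (add_pow_le (abs_nonneg _) (abs_nonneg c) 3)).trans_eq (by norm_num)
  calc ∫ ω, |f ω + c| ^ 3 ∂P ≤ ∫ ω, 4 * (|f ω| ^ 3 + |c| ^ 3) ∂P :=
        integral_mono_of_nonneg (.of_forall fun ω => by positivity)
          ((hf3.add (integrable_const _)).const_mul 4) (.of_forall hpoint)
    _ = _ := by
        rw [integral_const_mul, integral_add hf3 (integrable_const _)]
        simp

theorem integral_add_const_sq {f : Ω → ℝ} (hf : MemLp f 2 P) (hf0 : ∫ ω, f ω ∂P = 0) (c : ℝ) :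
    ∫ ω, (f ω + c) ^ 2 ∂P = ∫ ω, f ω ^ 2 ∂P + c ^ 2 := by
  have hint : Integrable (fun ω => 2 * c * f ω) P := (hf.integrable one_le_two).const_mul _
  have hint' : Integrable (fun ω => 2 * c * f ω + c ^ 2) P := hint.add (integrable_const _)
  calc ∫ ω, (f ω + c) ^ 2 ∂P = ∫ ω, (f ω ^ 2 + (2 * c * f ω + c ^ 2)) ∂P := by
        congr with ω
        ring
    _ = _ := by
        rw [integral_add hf.integrable_sq hint', integral_add hint (integrable_const _),
          integral_const_mul, hf0]
        simp

variable {ι : Type*} {Y : ι → Ω → ℝ}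

theorem integral_sum_sq_eq_sum (hind : iIndepFun Y P) (hY : ∀ i, MemLp (Y i) 2 P)
    (hY0 : ∀ i, ∫ ω, Y i ω ∂P = 0) (s : Finset ι) :
    ∫ ω, (∑ i ∈ s, Y i ω) ^ 2 ∂P = ∑ i ∈ s, ∫ ω, Y i ω ^ 2 ∂P := by
  have hsum0 : ∫ ω, (∑ i ∈ s, Y i) ω ∂P = 0 := by
    simp_rw [Finset.sum_apply]
    rw [integral_finsetSum _ fun i _ => (hY i).integrable one_le_two]
    exact Finset.sum_eq_zero fun i _ => hY0 i
  have hvar := IndepFun.variance_sum (s := s) (fun i _ => hY i) fun i _ j _ hij => hind.indepFun hij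
  rw [variance_of_integral_eq_zero (memLp_finsetSum' s fun i _ => hY i).1.aemeasurable hsum0]
    at hvar
  simpa only [Finset.sum_apply, variance_of_integral_eq_zero (hY _).1.aemeasurable (hY0 _)]
    using hvar

theorem integral_abs_sum_pow_three_le (hind : iIndepFun Y P) (hY : ∀ i, MemLp (Y i) 3 P)
    (hY0 : ∀ i, ∫ ω, Y i ω ∂P = 0) (s : Finset ι) :
    ∫ ω, |∑ i ∈ s, Y i ω| ^ 3 ∂P ≤ ∑ i ∈ s, ∫ ω, |Y i ω| ^ 3 ∂P
      + 3 * ((∑ i ∈ s, ∫ ω, Y i ω ^ 2 ∂P) * √(∑ i ∈ s, ∫ ω, Y i ω ^ 2 ∂P)) := by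
  classical
  have hY2 : ∀ i, MemLp (Y i) 2 P := fun i => (hY i).mono_exponent (by norm_num)
  induction s using Finset.induction_on with
  | empty => simp
  | insert i s hi ih =>
    set V := ∑ j ∈ s, ∫ ω, Y j ω ^ 2 ∂P
    have hVi : 0 ≤ ∫ ω, Y i ω ^ 2 ∂P := integral_nonneg fun ω => sq_nonneg _
    have hV : 0 ≤ V := Finset.sum_nonneg fun j _ => integral_nonneg fun ω => sq_nonneg _
    have hindep : IndepFun (fun ω => ∑ j ∈ s, Y j ω) (Y i) P := by
      simpa only [Finset.sum_fn] using
        hind.indepFun_finsetSum_of_notMem₀ (fun j => (hY j).1.aemeasurable) hi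
    have hL1 : ∫ ω, |∑ j ∈ s, Y j ω| ∂P ≤ √V :=
      (integral_abs_le_sqrt_integral_sq (memLp_finsetSum s fun j _ => hY2 j)).trans_eq
        (by rw [integral_sum_sq_eq_sum hind hY2 hY0 s])
    have hstep := integral_abs_add_pow_three_le hindep (memLp_finsetSum s fun j _ => hY j)
      (hY i) (hY0 i)
    have hsqrt : √V ≤ √(∫ ω, Y i ω ^ 2 ∂P + V) := Real.sqrt_le_sqrt (by linarith)
    simp only [Finset.sum_insert hi, add_comm (Y i _)]
    nlinarith [mul_le_mul_of_nonneg_right (hL1.trans hsqrt) hVi, mul_le_mul_of_nonneg_left hsqrt hV]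

end Rosenthal

section Truncation

theorem truncation_eq_self_or_zero {α : Type*} (f : α → ℝ) (A : ℝ) (x : α) :
    truncation f A x = f x ∨ truncation f A x = 0 := by
  by_cases h : f x ∈ Set.Ioc (-A) A <;> simp [truncation, h]

theorem abs_sub_truncation_le {α : Type*} (f : α → ℝ) (A : ℝ) (x : α) :
    |f x - truncation f A x| ≤ |f x| := by
  rcases truncation_eq_self_or_zero f A x with h | h <;> simp [h]

theorem sub_truncation_eq_zero_or_le {α : Type*} (f : α → ℝ) (A : ℝ) (x : α) :
    f x - truncation f A x = 0 ∨ A ≤ |f x - truncation f A x| := by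
  rcases lt_or_ge |f x| A with h | h
  · exact .inl (sub_eq_zero.2 (truncation_eq_self h).symm)
  · rcases truncation_eq_self_or_zero f A x with h' | h' <;> simp [h', h]

theorem sq_sub_truncation {α : Type*} (f : α → ℝ) (A : ℝ) (x : α) :
    (f x - truncation f A x) ^ 2 = f x ^ 2 - truncation f A x ^ 2 := by
  rcases truncation_eq_self_or_zero f A x with h | h <;> simp [h]

theorem abs_sub_truncation_pow_le {α : Type*} (f : α → ℝ) {A q : ℝ} (hA : 0 < A) {j : ℕ}
    (hj : j ≠ 0) (hjq : j ≤ q) (x : α) :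
    |f x - truncation f A x| ^ j ≤ A ^ (j - q) * |f x| ^ q := by
  have hf := abs_sub_truncation_le f A x
  rcases sub_truncation_eq_zero_or_le f A x with h | h
  · rw [h, abs_zero, zero_pow hj]
    positivity
  · have hfx : 0 < |f x| := hA.trans_le (h.trans hf)
    calc |f x - truncation f A x| ^ j ≤ |f x| ^ j := pow_le_pow_left₀ (abs_nonneg _) hf j
      _ = |f x| ^ (j - q) * |f x| ^ q := by
          rw [← Real.rpow_add hfx, sub_add_cancel, Real.rpow_natCast]
      _ ≤ A ^ (j - q) * |f x| ^ q :=
          mul_le_mul_of_nonneg_right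
            (Real.rpow_le_rpow_of_nonpos hA (h.trans hf) (sub_nonpos.2 hjq)) (by positivity)

theorem abs_truncation_pow_le {α : Type*} (f : α → ℝ) {A q : ℝ} (hA : 0 ≤ A) {j : ℕ}
    (hq : 0 < q) (hqj : q ≤ j) (x : α) :
    |truncation f A x| ^ j ≤ A ^ (j - q) * |f x| ^ q := by
  have hbound : |truncation f A x| ≤ A :=
    (abs_truncation_le_bound f A x).trans_eq (abs_of_nonneg hA)
  calc |truncation f A x| ^ j = |truncation f A x| ^ (j - q) * |truncation f A x| ^ q := by
        rw [← Real.rpow_add_of_nonneg (abs_nonneg _) (sub_nonneg.2 hqj) hq.le, sub_add_cancel,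
          Real.rpow_natCast]
    _ ≤ A ^ (j - q) * |f x| ^ q :=
        mul_le_mul (Real.rpow_le_rpow (abs_nonneg _) hbound (sub_nonneg.2 hqj))
          (Real.rpow_le_rpow (abs_nonneg _) (abs_truncation_le_abs_self f A x) hq.le)
          (by positivity) (by positivity)

variable {U : Type*} [MeasurableSpace U] {p : Measure U} {f : U → ℝ} {A q : ℝ} {j : ℕ}

theorem integral_abs_sub_truncation_pow_le (hf : Integrable (fun x => |f x| ^ q) p) (hA : 0 < A)
    (hj : j ≠ 0) (hjq : j ≤ q) :
    ∫ x, |f x - truncation f A x| ^ j ∂p ≤ A ^ (j - q) * ∫ x, |f x| ^ q ∂p := by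
  rw [← integral_const_mul]
  exact integral_mono_of_nonneg (.of_forall fun x => by positivity) (hf.const_mul _)
    (.of_forall (abs_sub_truncation_pow_le f hA hj hjq))

theorem integral_abs_truncation_pow_le (hf : Integrable (fun x => |f x| ^ q) p) (hA : 0 ≤ A)
    (hq : 0 < q) (hqj : q ≤ j) :
    ∫ x, |truncation f A x| ^ j ∂p ≤ A ^ (j - q) * ∫ x, |f x| ^ q ∂p := by
  rw [← integral_const_mul]
  exact integral_mono_of_nonneg (.of_forall fun x => by positivity) (hf.const_mul _)
    (.of_forall (abs_truncation_pow_le f hA hq hqj))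

end Truncation

section EmpiricalMean

variable {U : Type*} {N : ℕ}

/-- The mean of `f` over the points `s 0, …, s (N - 1)`, with the junk value `0` for `N = 0`. -/
noncomputable def empMean (s : Fin N → U) (f : U → ℝ) : ℝ := (N : ℝ)⁻¹ * ∑ n, f (s n)

theorem empMean_add (s : Fin N → U) (f g : U → ℝ) :
    empMean s (fun x => f x + g x) = empMean s f + empMean s g := by
  simp only [empMean, Finset.sum_add_distrib, mul_add]

theorem empMean_sub (s : Fin N → U) (f g : U → ℝ) :
    empMean s (fun x => f x - g x) = empMean s f - empMean s g := by
  simp only [empMean, Finset.sum_sub_distrib, mul_sub]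

theorem empMean_const (s : Fin N → U) (hN : N ≠ 0) (c : ℝ) : empMean s (fun _ => c) = c := by
  simp [empMean, hN]

theorem empMean_const_mul (s : Fin N → U) (c : ℝ) (f : U → ℝ) :
    empMean s (fun x => c * f x) = c * empMean s f := by
  simp only [empMean, ← Finset.mul_sum, mul_left_comm]

theorem empMean_sum {ι : Type*} (s : Fin N → U) (t : Finset ι) (f : ι → U → ℝ) :
    empMean s (fun x => ∑ i ∈ t, f i x) = ∑ i ∈ t, empMean s (f i) := by
  simp only [empMean, Finset.sum_comm (s := Finset.univ), Finset.mul_sum]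

theorem empMean_nonneg (s : Fin N → U) {f : U → ℝ} (hf : ∀ x, 0 ≤ f x) : 0 ≤ empMean s f :=
  mul_nonneg (by positivity) (Finset.sum_nonneg fun _ _ => hf _)

theorem abs_empMean_le (s : Fin N → U) (f : U → ℝ) : |empMean s f| ≤ empMean s fun x => |f x| := by
  rw [empMean, abs_mul, abs_of_nonneg (by positivity)]
  exact mul_le_mul_of_nonneg_left (Finset.abs_sum_le_sum_abs _ _) (by positivity)

end EmpiricalMean

section Sampling

variable {U Ω : Type*} [MeasurableSpace U] [MeasurableSpace Ω] {p : Measure U} {P : Measure Ω}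
  {u : ℕ → Ω → U} {f : U → ℝ} {N : ℕ}

theorem memLp_comp_of_hasLaw {X : Ω → U} (hX : HasLaw X p P) {q : ENNReal} (hf : MemLp f q p) :
    MemLp (fun ω => f (X ω)) q P :=
  MemLp.comp_of_map (by rwa [hX.map_eq]) hX.aemeasurable

/-- The first `N` terms of the random sequence `u`, at the outcome `ω`. -/
abbrev sample (u : ℕ → Ω → U) (N : ℕ) (ω : Ω) : Fin N → U := fun n => u n ω

theorem memLp_empMean_sample (hu : ∀ n, HasLaw (u n) p P) {q : ENNReal} (hf : MemLp f q p)
    (N : ℕ) : MemLp (fun ω => empMean (sample u N ω) f) q P :=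
  (memLp_finsetSum Finset.univ fun (n : Fin N) _ =>
    memLp_comp_of_hasLaw (hu n) hf).const_mul (N : ℝ)⁻¹

theorem integrable_empMean_sample (hu : ∀ n, HasLaw (u n) p P) (hf : Integrable f p) (N : ℕ) :
    Integrable (fun ω => empMean (sample u N ω) f) P :=
  memLp_one_iff_integrable.1 (memLp_empMean_sample hu (memLp_one_iff_integrable.2 hf) N)

theorem integral_empMean_sample (hu : ∀ n, HasLaw (u n) p P) (hf : Integrable f p) (hN : N ≠ 0) :
    ∫ ω, empMean (sample u N ω) f ∂P = ∫ x, f x ∂p := by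
  have hcomp : ∀ n, Integrable (fun ω => f (u n ω)) P := fun n =>
    memLp_one_iff_integrable.1 (memLp_comp_of_hasLaw (hu n) (memLp_one_iff_integrable.2 hf))
  have hint : ∀ n, ∫ ω, f (u n ω) ∂P = ∫ x, f x ∂p := fun n => (hu n).integral_comp hf.1
  simp only [empMean, integral_const_mul, integral_finsetSum _ fun _ _ => hcomp _, hint,
    Finset.sum_const, Finset.card_univ, Fintype.card_fin, nsmul_eq_mul]
  field_simp

theorem iIndepFun_comp_sample (hu : ∀ n, HasLaw (u n) p P) (hind : iIndepFun u P)
    (hf : AEMeasurable f p) (N : ℕ) : iIndepFun (fun (n : Fin N) ω => f (u n ω)) P :=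
  (hind.precomp Fin.val_injective).comp₀ (fun _ => f) (fun n => (hu n).aemeasurable)
    fun n => by rwa [(hu n).map_eq]

variable [IsProbabilityMeasure P]

theorem integral_empMean_sample_sq (hu : ∀ n, HasLaw (u n) p P) (hind : iIndepFun u P)
    (hf : MemLp f 2 p) (hf0 : ∫ x, f x ∂p = 0) (N : ℕ) :
    ∫ ω, empMean (sample u N ω) f ^ 2 ∂P = (N : ℝ)⁻¹ * ∫ x, f x ^ 2 ∂p := by
  have hcomp : ∀ g : U → ℝ, AEStronglyMeasurable g p → ∀ n, ∫ ω, g (u n ω) ∂P = ∫ x, g x ∂p :=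
    fun g hg n => (hu n).integral_comp hg
  simp only [empMean, mul_pow, integral_const_mul]
  rw [integral_sum_sq_eq_sum (iIndepFun_comp_sample hu hind hf.1.aemeasurable N)
    (fun n => memLp_comp_of_hasLaw (hu n) hf) (fun n => (hcomp f hf.1 n).trans hf0)]
  simp only [hcomp (fun x => f x ^ 2) (hf.1.pow 2), Finset.sum_const, Finset.card_univ,
    Fintype.card_fin, nsmul_eq_mul]
  field_simp

theorem integral_abs_empMean_sample_pow_three_le (hu : ∀ n, HasLaw (u n) p P)
    (hind : iIndepFun u P) (hf : MemLp f 3 p) (hf0 : ∫ x, f x ∂p = 0) (N : ℕ) :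
    ∫ ω, |empMean (sample u N ω) f| ^ 3 ∂P ≤ (N : ℝ)⁻¹ ^ 3 *
      (N * ∫ x, |f x| ^ 3 ∂p + 3 * ((N * ∫ x, f x ^ 2 ∂p) * √(N * ∫ x, f x ^ 2 ∂p))) := by
  have hcomp : ∀ g : U → ℝ, AEStronglyMeasurable g p → ∀ n, ∫ ω, g (u n ω) ∂P = ∫ x, g x ∂p :=
    fun g hg n => (hu n).integral_comp hg
  have hsum := integral_abs_sum_pow_three_le (iIndepFun_comp_sample hu hind hf.1.aemeasurable N)
    (fun n => memLp_comp_of_hasLaw (hu n) hf) (fun n => (hcomp f hf.1 n).trans hf0) Finset.univ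
  simp only [hcomp (fun x => f x ^ 2) (hf.1.pow 2), hcomp (fun x => |f x| ^ 3) (hf.1.norm.pow 3),
    Finset.sum_const, Finset.card_univ, Fintype.card_fin, nsmul_eq_mul] at hsum
  simp only [empMean, abs_mul, mul_pow, integral_const_mul, abs_inv, Nat.abs_cast]
  exact mul_le_mul_of_nonneg_left hsum (by positivity)

end Sampling

section TruncatedDeviation

/-- The rate `N ^ (-3 / 2)` of the remainder of the expansion. -/
noncomputable abbrev rate (N : ℕ) : ℝ := (N : ℝ) ^ (-(3 / 2) : ℝ)

theorem isBigO_rate_one : rate =O[atTop] fun _ => (1 : ℝ) :=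
  .of_bound 1 <| (eventually_ge_atTop 1).mono fun N hN => by
    rw [Real.norm_of_nonneg (by positivity), norm_one, one_mul]
    exact Real.rpow_le_one_of_one_le_of_nonpos (by exact_mod_cast hN) (by norm_num)

theorem rate_eq_inv_sqrt_pow_three (N : ℕ) : rate N = (√N)⁻¹ ^ 3 := by
  rw [Real.sqrt_eq_rpow, ← Real.rpow_neg N.cast_nonneg, ← Real.rpow_mul_natCast N.cast_nonneg]
  norm_num

theorem isBigO_rate_mul {g h : ℕ → ℝ} (hg : g =O[atTop] rate) (hh : h =O[atTop] rate) :
    (fun N => g N * h N) =O[atTop] rate := by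
  simpa only [mul_one] using hg.mul (hh.trans isBigO_rate_one)

variable {U Ω : Type*} {N : ℕ} {f : U → ℝ}

/-- The empirical mean over the `N` points of `s` of the part of `f` which is removed by the
truncation at the level `N`. -/
noncomputable def truncExcess (f : U → ℝ) (s : Fin N → U) : ℝ :=
  empMean s fun x => |f x - truncation f N x|

theorem truncExcess_nonneg (f : U → ℝ) (s : Fin N → U) : 0 ≤ truncExcess f s :=
  empMean_nonneg s fun _ => abs_nonneg _

theorem truncExcess_eq_zero_or_one_le (f : U → ℝ) (s : Fin N → U) :
    truncExcess f s = 0 ∨ 1 ≤ truncExcess f s := by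
  by_cases h : ∀ n, f (s n) - truncation f N (s n) = 0
  · left
    simp [truncExcess, empMean, h]
  · right
    obtain ⟨n, hn⟩ := not_forall.1 h
    have hN : (0 : ℝ) < N := Nat.cast_pos.2 n.pos
    have hle := ((sub_truncation_eq_zero_or_le f N (s n)).resolve_left hn).trans
      (Finset.single_le_sum (f := fun n => |f (s n) - truncation f N (s n)|)
        (fun _ _ => abs_nonneg _) (Finset.mem_univ n))
    rw [truncExcess, empMean, inv_mul_eq_div]
    exact (one_le_div hN).2 hle

variable [MeasurableSpace U] {p : Measure U} {u : ℕ → Ω → U}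

/-- The deviation of the empirical mean over the `N` points of `s` of the truncation of `f` at the
level `N` from the mean of `f` itself. -/
noncomputable def truncDev (p : Measure U) (f : U → ℝ) (s : Fin N → U) : ℝ :=
  empMean s (truncation f N) - ∫ x, f x ∂p

theorem truncDev_eq_centered_add_bias (hN : N ≠ 0) (p : Measure U) (f : U → ℝ) (s : Fin N → U) :
    truncDev p f s = empMean s (fun x => truncation f N x - ∫ x', truncation f N x' ∂p)
        + (∫ x, truncation f N x ∂p - ∫ x, f x ∂p) := by
  rw [truncDev, empMean_sub, empMean_const _ hN]
  ring

theorem abs_empMean_sub_integral_le (p : Measure U) (f : U → ℝ) (s : Fin N → U) :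
    |empMean s f - ∫ x, f x ∂p - truncDev p f s| ≤ truncExcess f s := by
  have h := abs_empMean_le s fun x => f x - truncation f N x
  rw [empMean_sub] at h
  refine le_of_eq_of_le (congrArg abs ?_) h
  rw [truncDev]
  ring

theorem integrable_abs_rpow_five_halves (hf : MemLp f (5 / 2) p) :
    Integrable (fun x => |f x| ^ (5 / 2 : ℝ)) p := by
  have h := hf.integrable_norm_rpow (by norm_num) (ENNReal.div_ne_top (by norm_num) (by norm_num))
  simpa using h

theorem isBigO_integral_abs_sub_truncation (hf : MemLp f (5 / 2) p) :
    (fun N : ℕ => ∫ x, |f x - truncation f N x| ∂p) =O[atTop] rate :=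
  .of_bound (∫ x, |f x| ^ (5 / 2 : ℝ) ∂p) <| (eventually_gt_atTop 0).mono fun N hN => by
    have h := integral_abs_sub_truncation_pow_le (A := N) (j := 1)
      (integrable_abs_rpow_five_halves hf) (by exact_mod_cast hN) one_ne_zero (by norm_num)
    rw [Real.norm_of_nonneg (integral_nonneg fun x => abs_nonneg _),
      Real.norm_of_nonneg (by positivity), mul_comm]
    convert h using 3 <;> norm_num

theorem isBigO_integral_sq_sub_truncation (hf : MemLp f (5 / 2) p) :
    (fun N : ℕ => (N : ℝ)⁻¹ * ∫ x, (f x - truncation f N x) ^ 2 ∂p) =O[atTop] rate :=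
  .of_bound (∫ x, |f x| ^ (5 / 2 : ℝ) ∂p) <| (eventually_gt_atTop 0).mono fun N hN => by
    have hN' : (0 : ℝ) < N := by exact_mod_cast hN
    have h := integral_abs_sub_truncation_pow_le (A := N) (j := 2)
      (integrable_abs_rpow_five_halves hf) hN' two_ne_zero (by norm_num)
    simp only [sq_abs] at h
    rw [Real.norm_of_nonneg (mul_nonneg (by positivity) (integral_nonneg fun x => sq_nonneg _)),
      Real.norm_of_nonneg (by positivity)]
    calc _ ≤ (N : ℝ)⁻¹ * ((N : ℝ) ^ (((2 : ℕ) : ℝ) - 5 / 2) * ∫ x, |f x| ^ (5 / 2 : ℝ) ∂p) := by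
          gcongr
      _ = _ := by
          rw [← mul_assoc, ← Real.rpow_neg_one, ← Real.rpow_add hN', mul_comm]
          norm_num

section FiniteMeasure

variable [IsFiniteMeasure p]

theorem memLp_two_of_memLp_five_halves (hf : MemLp f (5 / 2) p) : MemLp f 2 p :=
  hf.mono_exponent <| (ENNReal.le_div_iff_mul_le (by norm_num) (by norm_num)).2 (by norm_num)

theorem isBigO_integral_truncation_sub (hf : MemLp f (5 / 2) p) :
    (fun N : ℕ => ∫ x, truncation f N x ∂p - ∫ x, f x ∂p) =O[atTop] rate := by
  have hf1 : Integrable f p := (memLp_two_of_memLp_five_halves hf).integrable one_le_two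
  refine .trans (.of_norm_le fun N => ?_) (isBigO_integral_abs_sub_truncation hf)
  rw [← integral_sub hf.1.integrable_truncation hf1]
  simp_rw [abs_sub_comm (f _)]
  exact norm_integral_le_integral_norm _

theorem integrable_abs_sub_truncation (hf : MemLp f (5 / 2) p) (A : ℝ) :
    Integrable (fun x => |f x - truncation f A x|) p :=
  (((memLp_two_of_memLp_five_halves hf).integrable one_le_two).sub hf.1.integrable_truncation).abs

variable [MeasurableSpace Ω] {P : Measure Ω}

theorem integrable_truncExcess_sample (hu : ∀ n, HasLaw (u n) p P) (hf : MemLp f (5 / 2) p)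
    (N : ℕ) : Integrable (fun ω => truncExcess f (sample u N ω)) P :=
  integrable_empMean_sample hu (integrable_abs_sub_truncation hf N) N

theorem isBigO_integral_truncExcess (hu : ∀ n, HasLaw (u n) p P) (hf : MemLp f (5 / 2) p) :
    (fun N => ∫ ω, truncExcess f (sample u N ω) ∂P) =O[atTop] rate := by
  refine (isBigO_integral_abs_sub_truncation hf).congr' ?_ .rfl
  filter_upwards [eventually_ne_atTop 0] with N hN
  exact (integral_empMean_sample hu (integrable_abs_sub_truncation hf N) hN).symm

end FiniteMeasure

variable [IsProbabilityMeasure p]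

theorem integral_sq_centered_truncation (hf : MemLp f 2 p) (A : ℝ) :
    ∫ x, (truncation f A x - ∫ x', truncation f A x' ∂p) ^ 2 ∂p = ∫ x, f x ^ 2 ∂p
      - ∫ x, (f x - truncation f A x) ^ 2 ∂p - (∫ x, truncation f A x ∂p) ^ 2 := by
  have htrunc : MemLp (truncation f A) 2 p := hf.1.memLp_truncation
  simp only [sq_sub_truncation, integral_sub hf.integrable_sq htrunc.integrable_sq]
  rw [← variance_eq_integral htrunc.1.aemeasurable, variance_eq_sub htrunc]
  simp

theorem integral_abs_centered_truncation_pow_three_le (hf : MemLp f (5 / 2) p) {A : ℝ}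
    (hA : 0 ≤ A) :
    ∫ x, |truncation f A x - ∫ x', truncation f A x' ∂p| ^ 3 ∂p
      ≤ 4 * (√A * ∫ x, |f x| ^ (5 / 2 : ℝ) ∂p + (∫ x, |f x| ∂p) ^ 3) := by
  set m := ∫ x, truncation f A x ∂p
  have hf1 : Integrable f p := (memLp_two_of_memLp_five_halves hf).integrable one_le_two
  have hmean : |m| ≤ ∫ x, |f x| ∂p :=
    abs_integral_le_integral_abs.trans <| integral_mono hf.1.integrable_truncation.abs hf1.abs
      (abs_truncation_le_abs_self f A)
  have htrunc : ∫ x, |truncation f A x| ^ 3 ∂p ≤ √A * ∫ x, |f x| ^ (5 / 2 : ℝ) ∂p := by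
    convert integral_abs_truncation_pow_le (j := 3) (integrable_abs_rpow_five_halves hf) hA
      (by norm_num) (by norm_num) using 2
    rw [Real.sqrt_eq_rpow]
    norm_num
  simp only [sub_eq_add_neg]
  refine (integral_abs_add_const_pow_three_le hf.1.memLp_truncation (-m)).trans ?_
  rw [abs_neg]
  gcongr

variable [MeasurableSpace Ω] {P : Measure Ω} [IsProbabilityMeasure P]

theorem isBigO_integral_abs_empMean_truncation_pow_three (hu : ∀ n, HasLaw (u n) p P)
    (hind : iIndepFun u P) (hf : MemLp f (5 / 2) p) :
    (fun N : ℕ => ∫ ω, |empMean (sample u N ω)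
      fun x => truncation f N x - ∫ x', truncation f N x' ∂p| ^ 3 ∂P) =O[atTop] rate := by
  set M := ∫ x, |f x| ^ (5 / 2 : ℝ) ∂p
  set b := ∫ x, |f x| ∂p
  set V := ∫ x, f x ^ 2 ∂p
  refine .of_bound (4 * (M + b ^ 3) + 3 * (V * √V)) <| (eventually_ge_atTop 1).mono fun N hN => ?_
  set h : U → ℝ := fun x => truncation f N x - ∫ x', truncation f N x' ∂p with h_def
  have hf2 : MemLp f 2 p := memLp_two_of_memLp_five_halves hf
  have hh : MemLp h 3 p := hf.1.memLp_truncation.sub (memLp_const _)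
  have hh0 : ∫ x, h x ∂p = 0 := by
    rw [integral_sub hf.1.integrable_truncation (integrable_const _)]
    simp
  have hV : ∫ x, h x ^ 2 ∂p ≤ V := by
    rw [h_def, integral_sq_centered_truncation hf2]
    have : 0 ≤ ∫ x, (f x - truncation f N x) ^ 2 ∂p := integral_nonneg fun x => sq_nonneg _
    linarith [sq_nonneg (∫ x, truncation f N x ∂p)]
  have hthird := integral_abs_centered_truncation_pow_three_le hf N.cast_nonneg
  have hb : 0 ≤ b := integral_nonneg fun x => abs_nonneg _
  have ht : 1 ≤ √N := Real.one_le_sqrt.2 (by exact_mod_cast hN)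
  have htN : (N : ℝ) = √N ^ 2 := (Real.sq_sqrt N.cast_nonneg).symm
  rw [Real.norm_of_nonneg (integral_nonneg fun ω => by positivity), rate_eq_inv_sqrt_pow_three,
    Real.norm_of_nonneg (by positivity)]
  calc ∫ ω, |empMean (sample u N ω) h| ^ 3 ∂P
      ≤ (N : ℝ)⁻¹ ^ 3 * (N * (4 * (√N * M + b ^ 3)) + 3 * ((N * V) * √(N * V))) := by
        refine (integral_abs_empMean_sample_pow_three_le hu hind hh hh0 N).trans ?_
        gcongr
    _ ≤ (N : ℝ)⁻¹ ^ 3 * (N * (4 * (√N * M + √N * b ^ 3)) + 3 * ((N * V) * √(N * V))) := by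
        gcongr
        exact le_mul_of_one_le_left (pow_nonneg hb 3) ht
    _ = _ := by
        rw [Real.sqrt_mul N.cast_nonneg, htN, Real.sqrt_sq (by positivity)]
        field_simp

theorem memLp_truncDev (hu : ∀ n, HasLaw (u n) p P) (hf : AEStronglyMeasurable f p) (N : ℕ)
    (q : ENNReal) : MemLp (fun ω => truncDev p f (sample u N ω)) q P :=
  (memLp_empMean_sample hu hf.memLp_truncation N).sub (memLp_const _)

theorem isBigO_integral_abs_truncDev_pow_three (hu : ∀ n, HasLaw (u n) p P)
    (hind : iIndepFun u P) (hf : MemLp f (5 / 2) p) :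
    (fun N => ∫ ω, |truncDev p f (sample u N ω)| ^ 3 ∂P) =O[atTop] rate := by
  set b : ℕ → ℝ := fun N => ∫ x, truncation f N x ∂p - ∫ x, f x ∂p
  have hb : (fun N => |b N|) =O[atTop] rate := (isBigO_integral_truncation_sub hf).abs_left
  have hmain := ((isBigO_integral_abs_empMean_truncation_pow_three hu hind hf).add
    (isBigO_rate_mul (isBigO_rate_mul hb hb) hb)).const_mul_left 4
  refine .trans (.of_bound 1 <| (eventually_ne_atTop 0).mono fun N hN => ?_) hmain
  rw [Real.norm_of_nonneg (integral_nonneg fun ω => by positivity), one_mul, ← pow_three']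
  simp only [truncDev_eq_centered_add_bias hN]
  exact (integral_abs_add_const_pow_three_le (memLp_empMean_sample hu
    (hf.1.memLp_truncation.sub (memLp_const _)) N) (b N)).trans (le_abs_self _)

theorem isBigO_integral_truncDev_sq_sub (hu : ∀ n, HasLaw (u n) p P)
    (hind : iIndepFun u P) (hf : MemLp f (5 / 2) p) (hf0 : ∫ x, f x ∂p = 0) :
    (fun N : ℕ => ∫ ω, truncDev p f (sample u N ω) ^ 2 ∂P - (N : ℝ)⁻¹ * ∫ x, f x ^ 2 ∂p)
      =O[atTop] rate := by
  have hf2 := memLp_two_of_memLp_five_halves hf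
  set b : ℕ → ℝ := fun N => ∫ x, truncation f N x ∂p
  have hb : b =O[atTop] rate := by simpa [hf0] using isBigO_integral_truncation_sub hf
  have hinv : (fun N : ℕ => (N : ℝ)⁻¹) =O[atTop] fun _ => (1 : ℝ) :=
    tendsto_inv_atTop_nhds_zero_nat.isBigO_one ℝ
  have hbb := isBigO_rate_mul hb hb
  have hbb' : (fun N : ℕ => (N : ℝ)⁻¹ * (b N * b N)) =O[atTop] rate := by
    simpa only [one_mul] using hinv.mul hbb
  refine ((hbb.sub hbb').sub (isBigO_integral_sq_sub_truncation hf)).congr' ?_ .rfl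
  filter_upwards [eventually_ne_atTop 0] with N hN
  set h : U → ℝ := fun x => truncation f N x - b N with h_def
  have hh : MemLp h 2 p := hf.1.memLp_truncation.sub (memLp_const _)
  have hh0 : ∫ x, h x ∂p = 0 := by
    rw [integral_sub hf.1.integrable_truncation (integrable_const _)]
    simp [b]
  have hmean0 : ∫ ω, empMean (sample u N ω) h ∂P = 0 :=
    (integral_empMean_sample hu (hh.integrable one_le_two) hN).trans hh0
  simp only [truncDev_eq_centered_add_bias hN, hf0, sub_zero]
  rw [integral_add_const_sq (memLp_empMean_sample hu hh N) hmean0,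
    integral_empMean_sample_sq hu hind hh hh0, h_def, integral_sq_centered_truncation hf2]
  ring

end TruncatedDeviation

section LeastSquares

variable {U ι κ : Type*} [Fintype ι] [Fintype κ] {N : ℕ} {s : Fin N → U} {x : ι → U → ℝ}
  {z : U → ℝ} {v : ι → ℝ}

/-- The linear combination of the functions `x i` with weights `v`. -/
def readout (x : ι → U → ℝ) (v : ι → ℝ) (a : U) : ℝ := ∑ i, v i * x i a

/-- The empirical mean squared error of the approximation of `z` by `readout x v`. -/
noncomputable def empMse (s : Fin N → U) (x : ι → U → ℝ) (z : U → ℝ) (v : ι → ℝ) : ℝ :=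
  empMean s fun a => (z a - readout x v a) ^ 2

/-- The weights `v` solve the normal equations of the least-squares approximation of `z` by linear
combinations of the `x i` on the sample `s`: the residual is orthogonal to every `x i`. -/
def IsLeastSquares (s : Fin N → U) (x : ι → U → ℝ) (z : U → ℝ) (v : ι → ℝ) : Prop :=
  ∀ i, empMean s (fun a => x i a * (z a - readout x v a)) = 0

/-- The Gram matrix of the functions `x i` on the sample `s`; it is `empGram` for `ι = Fin K`. -/
noncomputable def sampleGram (s : Fin N → U) (x : ι → U → ℝ) : Matrix ι ι ℝ :=
  Matrix.of fun i j => empMean s fun a => x i a * x j a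

/-- The correlations of the functions `x i` with `z` on the sample `s`; this is `empCorr` for
`ι = Fin K`. -/
noncomputable def sampleCorr (s : Fin N → U) (x : ι → U → ℝ) (z : U → ℝ) : ι → ℝ :=
  fun i => empMean s fun a => x i a * z a

/-- The least-squares weights given by the pseudo-inverse of the Gram matrix of the sample. -/
noncomputable def sampleWeights (s : Fin N → U) (x : ι → U → ℝ) (z : U → ℝ) : ι → ℝ :=
  pinv (sampleGram s x) *ᵥ sampleCorr s x z

/-- The least empirical mean squared error of an approximation of `z` by linear combinations of the
functions `x i`. -/
noncomputable def minEmpMse (s : Fin N → U) (x : ι → U → ℝ) (z : U → ℝ) : ℝ :=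
  empMse s x z (sampleWeights s x z)

/-- The part of the empirical second moment of `z` which is explained by the functions `x i`. For
`ι = Fin K` it is the numerator of `empCapacity`. -/
noncomputable def explainedPower (s : Fin N → U) (x : ι → U → ℝ) (z : U → ℝ) : ℝ :=
  sampleCorr s x z ⬝ᵥ sampleWeights s x z

theorem empMean_mul_readout (s : Fin N → U) (g : U → ℝ) (x : ι → U → ℝ) (v : ι → ℝ) :
    empMean s (fun a => g a * readout x v a) = ∑ i, empMean s (fun a => g a * x i a) * v i := by
  simp only [readout, Finset.mul_sum, empMean_sum]
  refine Finset.sum_congr rfl fun i _ => ?_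
  rw [mul_comm, ← empMean_const_mul]
  congr with a
  ring

theorem isLeastSquares_iff_mulVec_eq :
    IsLeastSquares s x z v ↔ sampleGram s x *ᵥ v = sampleCorr s x z := by
  rw [funext_iff]
  refine forall_congr' fun i => ?_
  simp only [mul_sub, empMean_sub, empMean_mul_readout, sampleGram, sampleCorr,
    Matrix.mulVec, dotProduct, Matrix.of_apply]
  exact sub_eq_zero.trans eq_comm

theorem readout_sub (x : ι → U → ℝ) (v w : ι → ℝ) (a : U) :
    readout x (v - w) a = readout x v a - readout x w a := by
  simp only [readout, Pi.sub_apply, sub_mul, Finset.sum_sub_distrib]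

theorem IsLeastSquares.empMean_readout_mul_residual (hv : IsLeastSquares s x z v) (w : ι → ℝ) :
    empMean s (fun a => (z a - readout x v a) * readout x w a) = 0 := by
  rw [empMean_mul_readout]
  refine Finset.sum_eq_zero fun i _ => ?_
  simp only [mul_comm _ (x i _), hv i, zero_mul]

theorem IsLeastSquares.empMse_eq (hv : IsLeastSquares s x z v) (w : ι → ℝ) :
    empMse s x z w = empMse s x z v + empMean s fun a => readout x (v - w) a ^ 2 := by
  have hcross := hv.empMean_readout_mul_residual (v - w)
  calc empMse s x z w = empMean s fun a => ((z a - readout x v a) ^ 2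
        + 2 * ((z a - readout x v a) * readout x (v - w) a)) + readout x (v - w) a ^ 2 := by
        simp only [empMse, readout_sub]
        congr with a
        ring
    _ = _ := by
        rw [empMean_add, empMean_add, empMean_const_mul, hcross, mul_zero, add_zero, empMse]

theorem empMse_nonneg (s : Fin N → U) (x : ι → U → ℝ) (z : U → ℝ) (v : ι → ℝ) :
    0 ≤ empMse s x z v :=
  empMean_nonneg s fun _ => sq_nonneg _

theorem minEmpMse_nonneg (s : Fin N → U) (x : ι → U → ℝ) (z : U → ℝ) : 0 ≤ minEmpMse s x z :=
  empMse_nonneg s x z _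

theorem IsLeastSquares.empMse_le (hv : IsLeastSquares s x z v) (w : ι → ℝ) :
    empMse s x z v ≤ empMse s x z w := by
  rw [hv.empMse_eq w]
  exact le_add_of_nonneg_right (empMean_nonneg s fun _ => sq_nonneg _)

theorem empMse_zero (s : Fin N → U) (x : ι → U → ℝ) (z : U → ℝ) :
    empMse s x z 0 = empMean s fun a => z a ^ 2 := by
  simp [empMse, readout]

theorem IsLeastSquares.sampleCorr_dotProduct (hv : IsLeastSquares s x z v) :
    sampleCorr s x z ⬝ᵥ v = empMean s (fun a => z a ^ 2) - empMse s x z v := by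
  have hcross := hv.empMean_readout_mul_residual v
  calc _ = empMean s fun a => z a * readout x v a := by
        rw [empMean_mul_readout]
        simp only [sampleCorr, dotProduct, mul_comm (z _)]
    _ = empMean s (fun a => (z a ^ 2 - (z a - readout x v a) ^ 2)
        - (z a - readout x v a) * readout x v a) := by
        congr with a
        ring
    _ = _ := by rw [empMean_sub, empMean_sub, hcross, sub_zero, empMse]

theorem sampleGram_mulVec_sampleWeights (s : Fin N → U) (x : ι → U → ℝ) (z : U → ℝ) :
    sampleGram s x *ᵥ sampleWeights s x z = sampleCorr s x z := by
  classical
  set G := sampleGram s x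
  set D : Matrix (Fin N) ι ℝ := Matrix.of fun n i => x i (s n)
  have hG : G = (N : ℝ)⁻¹ • (Dᵀ * D) := by
    ext i j
    simp [G, D, sampleGram, empMean, Matrix.mul_apply]
  have hR : sampleCorr s x z = (N : ℝ)⁻¹ • (Dᵀ *ᵥ fun n => z (s n)) := by
    ext i
    simp [D, sampleCorr, empMean, Matrix.mulVec, dotProduct]
  have hpinv : (1 - G * pinv G) * G = 0 := by
    rw [sub_mul, one_mul, (isMoorePenrose_pinv (by simp [hG])).mul_mul_left, sub_self]
  have hD : (N : ℝ)⁻¹ • ((1 - G * pinv G) * Dᵀ) = 0 := by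
    rw [hG, mul_smul_comm, ← hG] at hpinv
    rcases smul_eq_zero.1 hpinv with h | h
    · rw [h, zero_smul]
    · rw [← Matrix.conjTranspose_eq_transpose_of_trivial, Matrix.mul_conjTranspose_mul_self_eq_zero]
        at h
      rw [← Matrix.conjTranspose_eq_transpose_of_trivial, h, smul_zero]
  have hzero : (1 - G * pinv G) *ᵥ sampleCorr s x z = 0 := by
    rw [hR, Matrix.mulVec_smul, Matrix.mulVec_mulVec, ← Matrix.smul_mulVec, hD, Matrix.zero_mulVec]
  rw [Matrix.sub_mulVec, Matrix.one_mulVec, ← Matrix.mulVec_mulVec] at hzero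
  exact (sub_eq_zero.1 hzero).symm

theorem isLeastSquares_sampleWeights (s : Fin N → U) (x : ι → U → ℝ) (z : U → ℝ) :
    IsLeastSquares s x z (sampleWeights s x z) :=
  isLeastSquares_iff_mulVec_eq.2 (sampleGram_mulVec_sampleWeights s x z)

theorem IsLeastSquares.empMse_eq_minEmpMse (hv : IsLeastSquares s x z v) :
    empMse s x z v = minEmpMse s x z :=
  (hv.empMse_le _).antisymm ((isLeastSquares_sampleWeights s x z).empMse_le v)

theorem minEmpMse_le (s : Fin N → U) (x : ι → U → ℝ) (z : U → ℝ) :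
    minEmpMse s x z ≤ empMean s fun a => z a ^ 2 :=
  ((isLeastSquares_sampleWeights s x z).empMse_le 0).trans_eq (empMse_zero s x z)

theorem isGLB_minEmpMse (s : Fin N → U) (x : ι → U → ℝ) (z : U → ℝ) :
    IsGLB {m | ∃ w : ι → ℚ, empMse s x z (fun i => (w i : ℝ)) = m} (minEmpMse s x z) := by
  refine ⟨?_, fun b hb => ?_⟩
  · rintro _ ⟨w, rfl⟩
    exact (isLeastSquares_sampleWeights s x z).empMse_le _
  · have hcont : Continuous fun w : ι → ℝ => empMse s x z w := by
      simp only [empMse, empMean, readout]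
      fun_prop
    have hdense : DenseRange fun (w : ι → ℚ) (i : ι) => ((w i : ℚ) : ℝ) :=
      DenseRange.piMap fun _ => Rat.denseRange_cast
    exact hdense.induction_on (p := fun w => b ≤ empMse s x z w) (sampleWeights s x z)
      (isClosed_le continuous_const hcont) fun w => hb ⟨w, rfl⟩

theorem readout_readout (x : ι → U → ℝ) (A : κ → ι → ℝ) (v : κ → ℝ) (a : U) :
    readout (fun k => readout x (A k)) v a = readout x (v ᵥ* Matrix.of A) a := by
  simp only [readout, Matrix.vecMul, dotProduct, Matrix.of_apply, Finset.mul_sum, Finset.sum_mul]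
  rw [Finset.sum_comm]
  simp only [mul_assoc]

/- Only the span of the functions and the residual matter, so the weights can be transported along
a change of spanning family that also removes a fitted part of the target. -/
theorem minEmpMse_change_basis {X : κ → U → ℝ} {y : U → ℝ} {A : κ → ι → ℝ} {B : ι → κ → ℝ}
    {c : ι → ℝ} (hX : ∀ n k, X k (s n) = readout x (A k) (s n))
    (hx : ∀ n i, x i (s n) = readout X (B i) (s n))
    (hy : ∀ n, y (s n) = readout x c (s n) + z (s n)) :
    minEmpMse s X y = minEmpMse s x z := by
  set v := sampleWeights s X y
  set w := v ᵥ* Matrix.of A - c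
  have hres : ∀ n, z (s n) - readout x w (s n) = y (s n) - readout X v (s n) := fun n => by
    have hXv : readout X v (s n) = readout x (v ᵥ* Matrix.of A) (s n) := by
      rw [← readout_readout]
      simp only [readout, hX]
    rw [hXv, hy, readout_sub]
    ring
  have hw : IsLeastSquares s x z w := fun i => by
    have := (isLeastSquares_sampleWeights s X y).empMean_readout_mul_residual (B i)
    simpa only [empMean, hres, hx, mul_comm (readout X (B i) _)] using this
  rw [← hw.empMse_eq_minEmpMse]
  simp only [minEmpMse, empMse, empMean, hres, v]

theorem explainedPower_eq (s : Fin N → U) (x : ι → U → ℝ) (z : U → ℝ) :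
    explainedPower s x z = empMean s (fun a => z a ^ 2) - minEmpMse s x z :=
  (isLeastSquares_sampleWeights s x z).sampleCorr_dotProduct

theorem explainedPower_nonneg (s : Fin N → U) (x : ι → U → ℝ) (z : U → ℝ) :
    0 ≤ explainedPower s x z := by
  rw [explainedPower_eq]
  exact sub_nonneg.2 (minEmpMse_le s x z)

theorem explainedPower_le (s : Fin N → U) (x : ι → U → ℝ) (z : U → ℝ) :
    explainedPower s x z ≤ empMean s fun a => z a ^ 2 := by
  rw [explainedPower_eq]
  exact sub_le_self _ (minEmpMse_nonneg s x z)

variable {Ω : Type*} [MeasurableSpace U] [MeasurableSpace Ω] {p : Measure U} {P : Measure Ω}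
  {u : ℕ → Ω → U}

theorem integrable_empMse_sample (hu : ∀ n, HasLaw (u n) p P) (hx : ∀ i, MemLp (x i) 2 p)
    (hz : MemLp z 2 p) (v : ι → ℝ) (N : ℕ) :
    Integrable (fun ω => empMse (sample u N ω) x z v) P :=
  integrable_empMean_sample hu
    (hz.sub (memLp_finsetSum Finset.univ fun i _ => (hx i).const_mul (v i))).integrable_sq N

theorem integrable_minEmpMse_sample (hu : ∀ n, HasLaw (u n) p P) (hx : ∀ i, MemLp (x i) 2 p)
    (hz : MemLp z 2 p) (N : ℕ) : Integrable (fun ω => minEmpMse (sample u N ω) x z) P := by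
  have hmeas : AEMeasurable (fun ω => minEmpMse (sample u N ω) x z) P :=
    .isGLB (fun w : ι → ℚ =>
      (integrable_empMse_sample hu hx hz (fun i => (w i : ℝ)) N).1.aemeasurable)
      (.of_forall fun ω => isGLB_minEmpMse (sample u N ω) x z)
  refine (integrable_empMean_sample hu hz.integrable_sq N).mono' hmeas.aestronglyMeasurable
    (.of_forall fun ω => ?_)
  rw [Real.norm_of_nonneg (minEmpMse_nonneg _ _ _)]
  exact minEmpMse_le _ _ _

theorem integrable_explainedPower_sample (hu : ∀ n, HasLaw (u n) p P)
    (hx : ∀ i, MemLp (x i) 2 p) (hz : MemLp z 2 p) (N : ℕ) :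
    Integrable (fun ω => explainedPower (sample u N ω) x z) P := by
  simp only [explainedPower_eq]
  exact (integrable_empMean_sample hu hz.integrable_sq N).sub
    (integrable_minEmpMse_sample hu hx hz N)

end LeastSquares

section Perturbation

variable {ι κ : Type*} [Fintype ι] [Fintype κ]

theorem norm_le_sum_abs (a : ι → ℝ) : ‖a‖ ≤ ∑ i, |a i| :=
  (pi_norm_le_iff_of_nonneg (Finset.sum_nonneg fun _ _ => abs_nonneg _)).2 fun i =>
    Finset.single_le_sum (f := fun i => |a i|) (fun _ _ => abs_nonneg _) (Finset.mem_univ i)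

theorem abs_dotProduct_le (a b : ι → ℝ) : |a ⬝ᵥ b| ≤ (∑ i, |a i|) * ‖b‖ := by
  rw [Finset.sum_mul]
  refine (Finset.abs_sum_le_sum_abs _ _).trans (Finset.sum_le_sum fun i _ => ?_)
  rw [abs_mul]
  exact mul_le_mul_of_nonneg_left (norm_le_pi_norm b i) (abs_nonneg _)

theorem norm_mulVec_le (A : Matrix κ ι ℝ) (b : ι → ℝ) :
    ‖A *ᵥ b‖ ≤ (∑ i, ∑ j, |A i j|) * ‖b‖ := by
  rw [Finset.sum_mul]
  exact (norm_le_sum_abs _).trans (Finset.sum_le_sum fun i _ => abs_dotProduct_le (A i) b)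

theorem dotProduct_self_le_sq {r : ι → ℝ} {δ : ℝ} (hr : ∑ i, |r i| ≤ δ) : r ⬝ᵥ r ≤ δ ^ 2 := by
  have hδ0 : 0 ≤ δ := (Finset.sum_nonneg fun _ _ => abs_nonneg _).trans hr
  rw [pow_two]
  refine (le_abs_self _).trans ((abs_dotProduct_le r r).trans ?_)
  gcongr
  exact (norm_le_sum_abs r).trans hr

variable [DecidableEq ι] {G : Matrix ι ι ℝ} {r v : ι → ℝ} {δ σ : ℝ}

theorem eq_sub_mulVec_of_mulVec_eq (hGv : G *ᵥ v = r) : v = r - (G - 1) *ᵥ v := by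
  rw [Matrix.sub_mulVec, Matrix.one_mulVec, hGv, sub_sub_cancel]

theorem norm_solution_le (hGv : G *ᵥ v = r) (hG : ∑ i, ∑ j, |(G - 1) i j| ≤ δ)
    (hr : ∑ i, |r i| ≤ δ) (hδ : δ ≤ 1 / 2) : ‖v‖ ≤ 2 * δ := by
  have hle : ‖v‖ ≤ δ + 1 / 2 * ‖v‖ := calc
    ‖v‖ = ‖r - (G - 1) *ᵥ v‖ := congrArg _ (eq_sub_mulVec_of_mulVec_eq hGv)
    _ ≤ ‖r‖ + ‖(G - 1) *ᵥ v‖ := norm_sub_le _ _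
    _ ≤ δ + 1 / 2 * ‖v‖ := by
        gcongr
        · exact (norm_le_sum_abs r).trans hr
        · refine (norm_mulVec_le _ _).trans ?_
          gcongr
          exact hG.trans hδ
  linarith

theorem abs_dotProduct_solution_sub_le (hGv : G *ᵥ v = r) (hG : ∑ i, ∑ j, |(G - 1) i j| ≤ δ)
    (hr : ∑ i, |r i| ≤ δ) (hδ : δ ≤ 1 / 2) : |r ⬝ᵥ v - r ⬝ᵥ r| ≤ 2 * δ ^ 3 := by
  have hδ0 : 0 ≤ δ := (Finset.sum_nonneg fun _ _ => abs_nonneg _).trans hr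
  calc |r ⬝ᵥ v - r ⬝ᵥ r| = |r ⬝ᵥ ((G - 1) *ᵥ v)| := by
        rw [← dotProduct_sub, ← abs_neg, ← dotProduct_neg, neg_sub,
          ← sub_eq_iff_eq_add.2 (sub_eq_iff_eq_add'.1 (eq_sub_mulVec_of_mulVec_eq hGv).symm)]
    _ ≤ δ * (δ * (2 * δ)) := by
        refine (abs_dotProduct_le _ _).trans ?_
        gcongr
        refine (norm_mulVec_le _ _).trans ?_
        gcongr
        exact norm_solution_le hGv hG hr hδ
    _ = 2 * δ ^ 3 := by ring

/- For large `δ` the matrix `G` may be singular; the a priori bound on `r ⬝ᵥ v` takes over. -/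
theorem abs_dotProduct_solution_sub_le_of_le (hGv : G *ᵥ v = r)
    (hG : ∑ i, ∑ j, |(G - 1) i j| ≤ δ) (hr : ∑ i, |r i| ≤ δ) (hσ : 0 ≤ σ) (hv0 : 0 ≤ r ⬝ᵥ v)
    (hv : r ⬝ᵥ v ≤ σ + δ) : |r ⬝ᵥ v - r ⬝ᵥ r| ≤ (8 * σ + 6) * δ ^ 3 := by
  have hδ0 : 0 ≤ δ := (Finset.sum_nonneg fun _ _ => abs_nonneg _).trans hr
  rcases le_total δ (1 / 2) with hδ | hδ
  · refine (abs_dotProduct_solution_sub_le hGv hG hr hδ).trans ?_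
    gcongr
    linarith
  · have h1 : δ ≤ 2 * δ ^ 2 := by nlinarith
    have h2 : δ ^ 2 ≤ 2 * δ ^ 3 := by nlinarith [sq_nonneg δ]
    have h3 : σ ≤ σ * (8 * δ ^ 3) := le_mul_of_one_le_right hσ (by linarith)
    have hself : 0 ≤ r ⬝ᵥ r := Finset.sum_nonneg fun i _ => mul_self_nonneg (r i)
    have := dotProduct_self_le_sq hr
    exact abs_sub_le_iff.2 ⟨by linarith, by linarith⟩

end Perturbation

section OrthonormalReadouts

variable {U ι : Type*} {N : ℕ} {s : Fin N → U} {x : ι → U → ℝ} {z : U → ℝ}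

/-- The products whose empirical means are the squared norm of `z`, the correlations of the `x i`
with `z` and the entries of the Gram matrix of the `x i`, as a single family. -/
def pairProduct (x : ι → U → ℝ) (z : U → ℝ) : Unit ⊕ ι ⊕ ι × ι → U → ℝ
  | .inl _, a => z a ^ 2
  | .inr (.inl i), a => x i a * z a
  | .inr (.inr (i, j)), a => x i a * x j a

/-- The total empirical mean of the parts of the products which are removed by the truncation. -/
noncomputable def totalExcess [Fintype ι] (x : ι → U → ℝ) (z : U → ℝ) (s : Fin N → U) : ℝ :=
  ∑ k, truncExcess (pairProduct x z k) s

theorem truncExcess_eq_zero_or_one_le_totalExcess [Fintype ι] (x : ι → U → ℝ) (z : U → ℝ)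
    (s : Fin N → U) :
    (∀ k, truncExcess (pairProduct x z k) s = 0) ∨ 1 ≤ totalExcess x z s := by
  by_cases h : ∀ k, truncExcess (pairProduct x z k) s = 0
  · exact .inl h
  · obtain ⟨k, hk⟩ := not_forall.1 h
    exact .inr <| ((truncExcess_eq_zero_or_one_le _ s).resolve_left hk).trans <|
      Finset.single_le_sum (fun k _ => truncExcess_nonneg (pairProduct x z k) s) (Finset.mem_univ k)

variable [MeasurableSpace U] {p : Measure U}

theorem memLp_pairProduct (hx : ∀ i, MemLp (x i) 5 p) (hz : MemLp z 5 p) (k : Unit ⊕ ι ⊕ ι × ι) :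
    MemLp (pairProduct x z k) (5 / 2) p := by
  have : ENNReal.HolderTriple 5 5 (5 / 2) := ⟨by
    rw [ENNReal.inv_div (by simp) (by simp), ← two_mul, div_eq_mul_inv]⟩
  rcases k with _ | i | ⟨i, j⟩
  · exact (hz.mul hz).ae_eq (.of_forall fun a => (pow_two (z a)).symm)
  · exact hz.mul (hx i)
  · exact (hx j).mul (hx i)

theorem empMean_pairProduct_eq (p : Measure U) {k : Unit ⊕ ι ⊕ ι × ι}
    (h : truncExcess (pairProduct x z k) s = 0) :
    empMean s (pairProduct x z k)
      = ∫ a, pairProduct x z k a ∂p + truncDev p (pairProduct x z k) s := by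
  have := abs_nonpos_iff.1 (h ▸ abs_empMean_sub_integral_le p (pairProduct x z k) s)
  linarith

variable [Fintype ι]

/-- The total deviation of the truncated empirical means of the products on the sample `s`. -/
noncomputable def totalDev (p : Measure U) (x : ι → U → ℝ) (z : U → ℝ) (s : Fin N → U) : ℝ :=
  ∑ k, |truncDev p (pairProduct x z k) s|

theorem totalDev_nonneg (p : Measure U) (x : ι → U → ℝ) (z : U → ℝ) (s : Fin N → U) :
    0 ≤ totalDev p x z s :=
  Finset.sum_nonneg fun _ _ => abs_nonneg _

theorem totalDev_eq (p : Measure U) (x : ι → U → ℝ) (z : U → ℝ) (s : Fin N → U) :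
    totalDev p x z s = |truncDev p (fun a => z a ^ 2) s|
      + (∑ i, |truncDev p (fun a => x i a * z a) s|
        + ∑ i, ∑ j, |truncDev p (fun a => x i a * x j a) s|) := by
  simp only [totalDev, Fintype.sum_sum_type, Fintype.sum_prod_type, Finset.univ_unique,
    Finset.sum_singleton]
  rfl

theorem totalDev_bounds (p : Measure U) (x : ι → U → ℝ) (z : U → ℝ) (s : Fin N → U) :
    |truncDev p (fun a => z a ^ 2) s| ≤ totalDev p x z s
      ∧ ∑ i, |truncDev p (fun a => x i a * z a) s| ≤ totalDev p x z s
      ∧ ∑ i, ∑ j, |truncDev p (fun a => x i a * x j a) s| ≤ totalDev p x z s := by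
  have hzz := abs_nonneg (truncDev p (fun a => z a ^ 2) s)
  have hr : 0 ≤ ∑ i, |truncDev p (fun a => x i a * z a) s| :=
    Finset.sum_nonneg fun i _ => abs_nonneg _
  have hG : 0 ≤ ∑ i, ∑ j, |truncDev p (fun a => x i a * x j a) s| :=
    Finset.sum_nonneg fun i _ => Finset.sum_nonneg fun j _ => abs_nonneg _
  rw [totalDev_eq]
  exact ⟨by linarith, by linarith, by linarith⟩

theorem empMean_sq_le (p : Measure U) (x : ι → U → ℝ) (z : U → ℝ) (s : Fin N → U) :
    empMean s (fun a => z a ^ 2)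
      ≤ ∫ a, z a ^ 2 ∂p + totalDev p x z s + totalExcess x z s := by
  have hmean := abs_empMean_sub_integral_le p (fun a => z a ^ 2) s
  have hexcess : truncExcess (fun a => z a ^ 2) s ≤ totalExcess x z s :=
    Finset.single_le_sum (f := fun k => truncExcess (pairProduct x z k) s)
      (fun k _ => truncExcess_nonneg _ s) (Finset.mem_univ (Sum.inl ()))
  linarith [(totalDev_bounds p x z s).1, abs_le.1 (hmean.trans hexcess),
    le_abs_self (truncDev p (fun a => z a ^ 2) s)]

theorem abs_explainedPower_sub_le_of_truncExcess_eq_zero [DecidableEq ι]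
    (hxx : ∀ i j, ∫ a, x i a * x j a ∂p = (1 : Matrix ι ι ℝ) i j)
    (hxz : ∀ i, ∫ a, x i a * z a ∂p = 0) (h : ∀ k, truncExcess (pairProduct x z k) s = 0) :
    |explainedPower s x z - ∑ i, truncDev p (fun a => x i a * z a) s ^ 2|
      ≤ (8 * ∫ a, z a ^ 2 ∂p + 6) * totalDev p x z s ^ 3 := by
  obtain ⟨-, hr, hG⟩ := totalDev_bounds p x z s
  have hcorr : sampleCorr s x z = fun i => truncDev p (fun a => x i a * z a) s := funext fun i =>
    (empMean_pairProduct_eq p (h (.inr (.inl i)))).trans (by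
      change ∫ a, x i a * z a ∂p + truncDev p (fun a => x i a * z a) s = _
      rw [hxz, zero_add])
  have hgram : ∀ i j, (sampleGram s x - 1) i j = truncDev p (fun a => x i a * x j a) s :=
    fun i j => by
      rw [Matrix.sub_apply, ← hxx i j, sub_eq_iff_eq_add']
      exact empMean_pairProduct_eq p (h (.inr (.inr (i, j))))
  have hle : explainedPower s x z ≤ ∫ a, z a ^ 2 ∂p + totalDev p x z s := by
    have := (explainedPower_le s x z).trans (empMean_sq_le p x z s)
    rwa [totalExcess, Finset.sum_eq_zero fun k _ => h k, add_zero] at this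
  have hself : sampleCorr s x z ⬝ᵥ sampleCorr s x z
      = ∑ i, truncDev p (fun a => x i a * z a) s ^ 2 := by
    simp only [hcorr, dotProduct, ← pow_two]
  rw [← hself]
  exact abs_dotProduct_solution_sub_le_of_le (δ := totalDev p x z s)
    (sampleGram_mulVec_sampleWeights s x z) (by simpa only [hgram] using hG)
    (by simpa only [hcorr] using hr) (integral_nonneg fun a => sq_nonneg (z a))
    (explainedPower_nonneg s x z) hle

theorem abs_explainedPower_sub_le_of_one_le_totalExcess (p : Measure U)
    (h : 1 ≤ totalExcess x z s) :
    |explainedPower s x z - ∑ i, truncDev p (fun a => x i a * z a) s ^ 2|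
      ≤ 2 * totalDev p x z s ^ 3 + (∫ a, z a ^ 2 ∂p + 3) * totalExcess x z s := by
  set δ := totalDev p x z s
  set σ := ∫ a, z a ^ 2 ∂p
  have hr : ∑ i, |truncDev p (fun a => x i a * z a) s| ≤ δ := (totalDev_bounds p x z s).2.1
  have hδ : 0 ≤ δ := totalDev_nonneg p x z s
  have hσ : σ ≤ σ * totalExcess x z s :=
    le_mul_of_one_le_right (integral_nonneg fun a => sq_nonneg _) h
  have hself : ∑ i, truncDev p (fun a => x i a * z a) s ^ 2 ≤ δ ^ 2 := by
    simpa only [dotProduct, ← pow_two] using dotProduct_self_le_sq hr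
  have hself0 : 0 ≤ ∑ i, truncDev p (fun a => x i a * z a) s ^ 2 := by positivity
  have h1 : δ ≤ 1 + δ ^ 3 := by nlinarith [sq_nonneg (δ - 1)]
  have h2 : δ ^ 2 ≤ 1 + δ ^ 3 := by nlinarith [sq_nonneg (δ - 1)]
  have hle : explainedPower s x z ≤ σ + δ + totalExcess x z s :=
    (explainedPower_le s x z).trans (empMean_sq_le p x z s)
  have := explainedPower_nonneg s x z
  exact abs_sub_le_iff.2 ⟨by linarith, by linarith⟩

theorem abs_explainedPower_sub_le [DecidableEq ι]
    (hxx : ∀ i j, ∫ a, x i a * x j a ∂p = (1 : Matrix ι ι ℝ) i j)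
    (hxz : ∀ i, ∫ a, x i a * z a ∂p = 0) (s : Fin N → U) :
    |explainedPower s x z - ∑ i, truncDev p (fun a => x i a * z a) s ^ 2|
      ≤ (8 * ∫ a, z a ^ 2 ∂p + 6) * totalDev p x z s ^ 3
        + (∫ a, z a ^ 2 ∂p + 3) * totalExcess x z s := by
  have hσ : 0 ≤ ∫ a, z a ^ 2 ∂p := integral_nonneg fun a => sq_nonneg _
  have hδ : 0 ≤ totalDev p x z s := totalDev_nonneg p x z s
  rcases truncExcess_eq_zero_or_one_le_totalExcess x z s with h | h
  · refine (abs_explainedPower_sub_le_of_truncExcess_eq_zero hxx hxz h).trans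
      (le_add_of_nonneg_right ?_)
    rw [totalExcess, Finset.sum_eq_zero fun k _ => h k, mul_zero]
  · refine (abs_explainedPower_sub_le_of_one_le_totalExcess p h).trans ?_
    gcongr
    linarith

end OrthonormalReadouts

section ExpectedExplainedPower

variable {U Ω ι : Type*} [MeasurableSpace U] [MeasurableSpace Ω] [Fintype ι] {p : Measure U}
  {P : Measure Ω} {u : ℕ → Ω → U} {x : ι → U → ℝ} {z : U → ℝ}

theorem totalDev_pow_three_le (p : Measure U) (x : ι → U → ℝ) (z : U → ℝ) {N : ℕ}
    (s : Fin N → U) : totalDev p x z s ^ 3 ≤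
      (Fintype.card (Unit ⊕ ι ⊕ ι × ι) : ℝ) ^ 2 * ∑ k, |truncDev p (pairProduct x z k) s| ^ 3 := by
  have hcard : (0 : ℝ) < (Fintype.card (Unit ⊕ ι ⊕ ι × ι) : ℝ) ^ 2 := by positivity
  rw [← div_le_iff₀' hcard]
  exact pow_sum_div_card_le_sum_pow (fun k _ => abs_nonneg (truncDev p (pairProduct x z k) s)) 2

theorem integrable_totalExcess_sample [IsFiniteMeasure p] (hu : ∀ n, HasLaw (u n) p P)
    (hx : ∀ i, MemLp (x i) 5 p) (hz : MemLp z 5 p) (N : ℕ) :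
    Integrable (fun ω => totalExcess x z (sample u N ω)) P :=
  integrable_finsetSum _ fun k _ => integrable_truncExcess_sample hu (memLp_pairProduct hx hz k) N

theorem isBigO_integral_totalExcess [IsFiniteMeasure p] (hu : ∀ n, HasLaw (u n) p P)
    (hx : ∀ i, MemLp (x i) 5 p) (hz : MemLp z 5 p) :
    (fun N => ∫ ω, totalExcess x z (sample u N ω) ∂P) =O[atTop] rate := by
  simp only [totalExcess, integral_finsetSum _ fun k _ =>
    integrable_truncExcess_sample hu (memLp_pairProduct hx hz k) _]
  exact .fun_sum fun k _ => isBigO_integral_truncExcess hu (memLp_pairProduct hx hz k)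

variable [IsProbabilityMeasure p] [IsProbabilityMeasure P]

theorem integrable_abs_truncDev_pow_three (hu : ∀ n, HasLaw (u n) p P) {f : U → ℝ}
    (hf : AEStronglyMeasurable f p) (N : ℕ) :
    Integrable (fun ω => |truncDev p f (sample u N ω)| ^ 3) P :=
  (memLp_truncDev hu hf N 3).integrable_norm_pow three_ne_zero

theorem integrable_totalDev_pow_three (hu : ∀ n, HasLaw (u n) p P)
    (hx : ∀ i, MemLp (x i) 5 p) (hz : MemLp z 5 p) (N : ℕ) :
    Integrable (fun ω => totalDev p x z (sample u N ω) ^ 3) P :=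
  have h : MemLp (fun ω => totalDev p x z (sample u N ω)) 3 P :=
    memLp_finsetSum _ fun k _ => (memLp_truncDev hu (memLp_pairProduct hx hz k).1 N 3).abs
  (h.integrable_norm_pow three_ne_zero).congr <| .of_forall fun _ =>
    congrArg (· ^ 3) (Real.norm_of_nonneg (totalDev_nonneg p x z _))

theorem isBigO_integral_totalDev_pow_three (hu : ∀ n, HasLaw (u n) p P)
    (hind : iIndepFun u P) (hx : ∀ i, MemLp (x i) 5 p) (hz : MemLp z 5 p) :
    (fun N => ∫ ω, totalDev p x z (sample u N ω) ^ 3 ∂P) =O[atTop] rate := by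
  have hint : ∀ k N, Integrable (fun ω => |truncDev p (pairProduct x z k) (sample u N ω)| ^ 3) P :=
    fun k N => integrable_abs_truncDev_pow_three hu (memLp_pairProduct hx hz k).1 N
  have hsum : (fun N => ∑ k, ∫ ω, |truncDev p (pairProduct x z k) (sample u N ω)| ^ 3 ∂P)
      =O[atTop] rate :=
    .fun_sum fun k _ => isBigO_integral_abs_truncDev_pow_three hu hind (memLp_pairProduct hx hz k)
  refine .trans (.of_bound' (.of_forall fun N => ?_))
    (hsum.const_mul_left ((Fintype.card (Unit ⊕ ι ⊕ ι × ι) : ℝ) ^ 2))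
  rw [Real.norm_of_nonneg (integral_nonneg fun ω => pow_nonneg (totalDev_nonneg p x z _) 3)]
  refine le_trans ?_ (le_abs_self _)
  rw [← integral_finsetSum _ fun k _ => hint k N, ← integral_const_mul]
  exact integral_mono (integrable_totalDev_pow_three hu hx hz N)
    ((integrable_finsetSum _ fun k _ => hint k N).const_mul _)
    fun ω => totalDev_pow_three_le p x z (sample u N ω)

theorem isBigO_integral_explainedPower_sub_sum_truncDev_sq [DecidableEq ι]
    (hu : ∀ n, HasLaw (u n) p P) (hind : iIndepFun u P) (hx : ∀ i, MemLp (x i) 5 p)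
    (hz : MemLp z 5 p)
    (hxx : ∀ i j, ∫ a, x i a * x j a ∂p = (1 : Matrix ι ι ℝ) i j)
    (hxz : ∀ i, ∫ a, x i a * z a ∂p = 0) :
    (fun N => ∫ ω, (explainedPower (sample u N ω) x z
      - ∑ i, truncDev p (fun a => x i a * z a) (sample u N ω) ^ 2) ∂P) =O[atTop] rate := by
  set σ := ∫ a, z a ^ 2 ∂p
  have hdev := (isBigO_integral_totalDev_pow_three hu hind hx hz).const_mul_left (8 * σ + 6)
  have hexcess := (isBigO_integral_totalExcess hu hx hz).const_mul_left (σ + 3)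
  refine .trans (.of_bound' (.of_forall fun N => ?_)) (hdev.add hexcess)
  have hdev_int := (integrable_totalDev_pow_three hu hx hz N).const_mul (8 * σ + 6)
  have hexcess_int := (integrable_totalExcess_sample hu hx hz N).const_mul (σ + 3)
  refine le_trans ?_ (le_abs_self _)
  rw [← integral_const_mul (8 * σ + 6), ← integral_const_mul (σ + 3),
    ← integral_add hdev_int hexcess_int]
  exact norm_integral_le_of_norm_le (hdev_int.add hexcess_int)
    (.of_forall fun ω => abs_explainedPower_sub_le hxx hxz (sample u N ω))

theorem isBigO_integral_explainedPower_sub [DecidableEq ι] (hu : ∀ n, HasLaw (u n) p P)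
    (hind : iIndepFun u P) (hx : ∀ i, MemLp (x i) 5 p) (hz : MemLp z 5 p)
    (hxx : ∀ i j, ∫ a, x i a * x j a ∂p = (1 : Matrix ι ι ℝ) i j)
    (hxz : ∀ i, ∫ a, x i a * z a ∂p = 0) :
    (fun N : ℕ => ∫ ω, explainedPower (sample u N ω) x z ∂P
      - (N : ℝ)⁻¹ * ∑ i, ∫ a, (x i a * z a) ^ 2 ∂p) =O[atTop] rate := by
  have hxz5 : ∀ i, MemLp (fun a => x i a * z a) (5 / 2) p := fun i =>
    memLp_pairProduct hx hz (.inr (.inl i))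
  have hsq : ∀ i N, Integrable
      (fun ω => truncDev p (fun a => x i a * z a) (sample u N ω) ^ 2) P := fun i N =>
    (memLp_truncDev hu (hxz5 i).1 N 2).integrable_sq
  have hvar : (fun N : ℕ => ∑ i, (∫ ω, truncDev p (fun a => x i a * z a) (sample u N ω) ^ 2 ∂P
      - (N : ℝ)⁻¹ * ∫ a, (x i a * z a) ^ 2 ∂p)) =O[atTop] rate :=
    .fun_sum fun i _ => isBigO_integral_truncDev_sq_sub hu hind (hxz5 i) (hxz i)
  have hpower : ∀ N, Integrable (fun ω => explainedPower (sample u N ω) x z) P :=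
    integrable_explainedPower_sample hu (fun i => (hx i).mono_exponent (by norm_num))
      (hz.mono_exponent (by norm_num))
  have hrem := isBigO_integral_explainedPower_sub_sum_truncDev_sq hu hind hx hz hxx hxz
  refine (hrem.add hvar).congr_left fun N => ?_
  rw [integral_sub (hpower N) (integrable_finsetSum _ fun i _ => hsq i N),
    integral_finsetSum _ fun i _ => hsq i N, Finset.sum_sub_distrib, Finset.mul_sum]
  ring

end ExpectedExplainedPower

section OrthonormalDecomposition

variable {U ι κ : Type*} [MeasurableSpace U] [Fintype ι] [Fintype κ] {p : Measure U}

theorem memLp_readout {x : ι → U → ℝ} {q : ENNReal} (hx : ∀ i, MemLp (x i) q p) (v : ι → ℝ) :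
    MemLp (readout x v) q p :=
  memLp_finsetSum _ fun i _ => (hx i).const_mul (v i)

theorem integral_mul_readout_eq_zero {x : ι → U → ℝ} {z : U → ℝ} (hx : ∀ i, MemLp (x i) 2 p)
    (hz : MemLp z 2 p) (hxz : ∀ i, ∫ a, x i a * z a ∂p = 0) (v : ι → ℝ) :
    ∫ a, readout x v a * z a ∂p = 0 := by
  have hint : ∀ i, Integrable (fun a => v i * (x i a * z a)) p := fun i =>
    ((hx i).integrable_mul hz).const_mul (v i)
  simp only [readout, Finset.sum_mul, mul_assoc]
  rw [integral_finsetSum _ fun i _ => hint i]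
  simp only [integral_const_mul, hxz, mul_zero, Finset.sum_const_zero]

theorem integral_add_sq_of_integral_mul_eq_zero {f g : U → ℝ} (hf : MemLp f 2 p)
    (hg : MemLp g 2 p) (hfg : ∫ a, f a * g a ∂p = 0) :
    ∫ a, (f a + g a) ^ 2 ∂p = ∫ a, f a ^ 2 ∂p + ∫ a, g a ^ 2 ∂p := by
  have hcross : Integrable (fun a => 2 * (f a * g a)) p := (hf.integrable_mul hg).const_mul 2
  have hleft : Integrable (fun a => f a ^ 2 + 2 * (f a * g a)) p := hf.integrable_sq.add hcross
  simp only [add_sq, mul_assoc]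
  rw [integral_add hleft hg.integrable_sq,
    integral_add hf.integrable_sq hcross, integral_const_mul, hfg, mul_zero, add_zero]

/-- The functions `x i` are orthonormal and have the same span as the readouts `X k`, with
coefficients `A` and `B`; the target `y` is a combination of the `x i`, with coefficients `c`, plus
a residual `z` orthogonal to them. Identities between functions hold almost everywhere. -/
structure IsOrthonormalDecomposition [DecidableEq ι] (p : Measure U) (X : κ → U → ℝ) (y : U → ℝ)
    (x : ι → U → ℝ) (z : U → ℝ) (A : κ → ι → ℝ) (B : ι → κ → ℝ) (c : ι → ℝ) : Prop where
  integral_mul : ∀ i j, ∫ a, x i a * x j a ∂p = (1 : Matrix ι ι ℝ) i j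
  integral_mul_residual : ∀ i, ∫ a, x i a * z a ∂p = 0
  readout_ae : ∀ k, ∀ᵐ a ∂p, X k a = readout x (A k) a
  basis_ae : ∀ i, ∀ᵐ a ∂p, x i a = readout X (B i) a
  target_ae : ∀ᵐ a ∂p, y a = readout x c a + z a

namespace IsOrthonormalDecomposition

variable [DecidableEq ι] {X : κ → U → ℝ} {y : U → ℝ} {x : ι → U → ℝ} {z : U → ℝ} {A : κ → ι → ℝ}
  {B : ι → κ → ℝ} {c : ι → ℝ} {q : ENNReal}

theorem memLp_basis (h : IsOrthonormalDecomposition p X y x z A B c)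
    (hX : ∀ k, MemLp (X k) q p) (i : ι) : MemLp (x i) q p :=
  (memLp_readout hX (B i)).ae_eq ((h.basis_ae i).mono fun _ => Eq.symm)

theorem memLp_residual (h : IsOrthonormalDecomposition p X y x z A B c)
    (hX : ∀ k, MemLp (X k) q p) (hy : MemLp y q p) : MemLp z q p :=
  (hy.sub (memLp_readout (h.memLp_basis hX) c)).ae_eq <| h.target_ae.mono fun a ha => by
    rw [Pi.sub_apply, ha, add_sub_cancel_left]

theorem readout_eq_ae (h : IsOrthonormalDecomposition p X y x z A B c) (W : κ → ℝ) :
    ∀ᵐ a ∂p, readout X W a = readout x (W ᵥ* Matrix.of A) a := by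
  filter_upwards [ae_all_iff.2 h.readout_ae] with a ha
  rw [← readout_readout]
  simp only [readout, ha]

theorem readout_basis_eq_ae (h : IsOrthonormalDecomposition p X y x z A B c) (v : ι → ℝ) :
    ∀ᵐ a ∂p, readout x v a = readout X (v ᵥ* Matrix.of B) a := by
  filter_upwards [ae_all_iff.2 h.basis_ae] with a ha
  rw [← readout_readout]
  simp only [readout, ha]

variable {Ω : Type*} [MeasurableSpace Ω] {P : Measure Ω} {u : ℕ → Ω → U}

theorem explainedPower_sample_eq_ae (h : IsOrthonormalDecomposition p X y x z A B c)
    (hu : ∀ n, HasLaw (u n) p P) (N : ℕ) :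
    ∀ᵐ ω ∂P, explainedPower (sample u N ω) X y = empMean (sample u N ω) (fun a => y a ^ 2)
      - empMean (sample u N ω) (fun a => z a ^ 2) + explainedPower (sample u N ω) x z := by
  have htransfer : ∀ {Q : U → Prop}, (∀ᵐ a ∂p, Q a) → ∀ᵐ ω ∂P, ∀ n : Fin N, Q (u n ω) :=
    fun hQ => ae_all_iff.2 fun n => ae_of_ae_map (hu n).aemeasurable (by rwa [(hu n).map_eq])
  filter_upwards [htransfer (ae_all_iff.2 h.readout_ae), htransfer (ae_all_iff.2 h.basis_ae),
    htransfer h.target_ae] with ω hX hx hy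
  rw [explainedPower_eq, explainedPower_eq, minEmpMse_change_basis hX hx hy]
  ring

theorem integral_explainedPower_sample (h : IsOrthonormalDecomposition p X y x z A B c)
    (hu : ∀ n, HasLaw (u n) p P) (hX : ∀ k, MemLp (X k) 2 p) (hy : MemLp y 2 p) {N : ℕ}
    (hN : N ≠ 0) : ∫ ω, explainedPower (sample u N ω) X y ∂P
      = ∫ a, y a ^ 2 ∂p - ∫ a, z a ^ 2 ∂p + ∫ ω, explainedPower (sample u N ω) x z ∂P := by
  have hz := h.memLp_residual hX hy
  have hyN := integrable_empMean_sample hu hy.integrable_sq N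
  have hzN := integrable_empMean_sample hu hz.integrable_sq N
  have hdiff : Integrable (fun ω => empMean (sample u N ω) (fun a => y a ^ 2)
      - empMean (sample u N ω) fun a => z a ^ 2) P := hyN.sub hzN
  rw [integral_congr_ae (h.explainedPower_sample_eq_ae hu N), integral_add hdiff
    (integrable_explainedPower_sample hu (h.memLp_basis hX) hz N), integral_sub hyN hzN,
    integral_empMean_sample hu hy.integrable_sq hN, integral_empMean_sample hu hz.integrable_sq hN]

variable {K : ℕ} {X : Fin K → U → ℝ} {A : Fin K → ι → ℝ} {B : ι → Fin K → ℝ}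

theorem mse_eq (h : IsOrthonormalDecomposition p X y x z A B c) (hX : ∀ k, MemLp (X k) 2 p)
    (hy : MemLp y 2 p) (W : Fin K → ℝ) : mse p X y W
      = ∫ a, readout x (c - W ᵥ* Matrix.of A) a ^ 2 ∂p + ∫ a, z a ^ 2 ∂p := by
  have hx := h.memLp_basis hX
  have hz := h.memLp_residual hX hy
  rw [← integral_add_sq_of_integral_mul_eq_zero (memLp_readout hx _) hz
    (integral_mul_readout_eq_zero hx hz h.integral_mul_residual _)]
  refine integral_congr_ae ?_
  filter_upwards [h.readout_eq_ae W, h.target_ae] with a hW hya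
  change (readout X W a - y a) ^ 2 = _
  rw [hW, hya, readout_sub]
  ring

theorem mse_eq_integral_residual_sq (h : IsOrthonormalDecomposition p X y x z A B c) :
    mse p X y (c ᵥ* Matrix.of B) = ∫ a, z a ^ 2 ∂p := by
  refine integral_congr_ae ?_
  filter_upwards [h.readout_basis_eq_ae c, h.target_ae] with a hc hya
  change (readout X (c ᵥ* Matrix.of B) a - y a) ^ 2 = _
  rw [← hc, hya]
  ring

theorem capacity_eq (h : IsOrthonormalDecomposition p X y x z A B c)
    (hX : ∀ k, MemLp (X k) 2 p) (hy : MemLp y 2 p) :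
    capacity p X y = 1 - (∫ a, z a ^ 2 ∂p) / ∫ a, y a ^ 2 ∂p := by
  have hleast : IsLeast (Set.range (mse p X y)) (∫ a, z a ^ 2 ∂p) := by
    refine ⟨⟨_, h.mse_eq_integral_residual_sq⟩, ?_⟩
    rintro _ ⟨W, rfl⟩
    rw [h.mse_eq hX hy W]
    exact le_add_of_nonneg_left (integral_nonneg fun a => sq_nonneg _)
  rw [capacity, hleast.isGLB.ciInf_eq]

variable [IsProbabilityMeasure p] [IsProbabilityMeasure P]

theorem isBigO_integral_empCapacity_sub (h : IsOrthonormalDecomposition p X y x z A B c)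
    (hX : ∀ k, MemLp (X k) 5 p) (hy : MemLp y 5 p) (hy0 : ∫ a, y a ^ 2 ∂p ≠ 0)
    (hu : ∀ n, HasLaw (u n) p P) (hind : iIndepFun u P) :
    (fun N : ℕ => ∫ ω, empCapacity p X y (sample u N ω) ∂P - (capacity p X y
      + (∑ i, ∫ a, (x i a * z a) ^ 2 ∂p) / (∫ a, y a ^ 2 ∂p) / N)) =O[atTop] rate := by
  have hX2 : ∀ k, MemLp (X k) 2 p := fun k => (hX k).mono_exponent (by norm_num)
  have hy2 : MemLp y 2 p := hy.mono_exponent (by norm_num)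
  have hexpansion := isBigO_integral_explainedPower_sub hu hind (h.memLp_basis hX)
    (h.memLp_residual hX hy) h.integral_mul h.integral_mul_residual
  refine (hexpansion.const_mul_left (∫ a, y a ^ 2 ∂p)⁻¹).congr' ?_ .rfl
  filter_upwards [eventually_ne_atTop 0] with N hN
  have hmean : ∫ ω, empCapacity p X y (sample u N ω) ∂P = (∫ a, y a ^ 2 ∂p - ∫ a, z a ^ 2 ∂p
      + ∫ ω, explainedPower (sample u N ω) x z ∂P) / ∫ a, y a ^ 2 ∂p := by
    rw [← h.integral_explainedPower_sample hu hX2 hy2 hN, ← integral_div]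
    rfl
  rw [hmean, h.capacity_eq hX2 hy2]
  field_simp
  ring

end IsOrthonormalDecomposition

end OrthonormalDecomposition

section L2

variable {U : Type*} [MeasurableSpace U] {p : Measure U} {K : ℕ} {X : Fin K → U → ℝ} {y : U → ℝ}
  {ι κ : Type*} [Fintype ι] [Fintype κ]

theorem coeFn_sum_smul_ae (v : κ → ℝ) (f : κ → Lp ℝ 2 p) :
    ∀ᵐ a ∂p, (∑ k, v k • f k : Lp ℝ 2 p) a = readout (fun k => f k) v a := by
  have hsmul : ∀ᵐ a ∂p, ∀ k, (v k • f k : Lp ℝ 2 p) a = v k * f k a :=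
    ae_all_iff.2 fun k => Lp.coeFn_smul (v k) (f k)
  filter_upwards [Lp.coeFn_fun_finsetSum Finset.univ fun k => v k • f k, hsmul] with a hsum hsmul
  rw [hsum]
  exact Finset.sum_congr rfl fun k _ => hsmul k

theorem integral_coeFn_mul (f g : Lp ℝ 2 p) : ∫ a, f a * g a ∂p = inner ℝ f g := by
  rw [L2.inner_def]
  exact integral_congr_ae (.of_forall fun a => mul_comm _ _)

variable (hX : ∀ i, MemLp (X i) 2 p) (Xt : OrthonormalBasis ι ℝ (readoutSpace p X hX))

theorem exists_eq_sum_smul_of_mem_readoutSpace {f : Lp ℝ 2 p} (hf : f ∈ readoutSpace p X hX) :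
    ∃ v : ι → ℝ, f = ∑ i, v i • (Xt i : Lp ℝ 2 p) :=
  ⟨Xt.repr ⟨f, hf⟩, by simpa using congrArg Subtype.val (Xt.sum_repr ⟨f, hf⟩).symm⟩

theorem exists_readout_eq_ae (k : Fin K) :
    ∃ v : ι → ℝ, ∀ᵐ a ∂p, X k a = readout (fun i => (Xt i : Lp ℝ 2 p)) v a := by
  obtain ⟨v, hv⟩ := exists_eq_sum_smul_of_mem_readoutSpace hX Xt
    (Submodule.subset_span ⟨k, rfl⟩ : (hX k).toLp (X k) ∈ readoutSpace p X hX)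
  refine ⟨v, ?_⟩
  filter_upwards [(hX k).coeFn_toLp, coeFn_sum_smul_ae v fun i => (Xt i : Lp ℝ 2 p)] with a hXa hsum
  rw [← hXa, hv, hsum]

theorem exists_basis_eq_ae (i : ι) :
    ∃ w : Fin K → ℝ, ∀ᵐ a ∂p, (Xt i : Lp ℝ 2 p) a = readout X w a := by
  obtain ⟨w, hw⟩ := (Submodule.mem_span_range_iff_exists_fun ℝ).1 (Xt i).2
  refine ⟨w, ?_⟩
  filter_upwards [ae_all_iff.2 fun k => (hX k).coeFn_toLp,
    coeFn_sum_smul_ae w fun k => (hX k).toLp (X k)] with a hXa hsum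
  rw [← hw, hsum]
  simp only [readout, hXa]

theorem exists_target_eq_ae (hy : MemLp y 2 p) : ∃ c : ι → ℝ, ∀ᵐ a ∂p,
    y a = readout (fun i => (Xt i : Lp ℝ 2 p)) c a + orthComponent p X y hX hy a := by
  obtain ⟨c, hc⟩ := exists_eq_sum_smul_of_mem_readoutSpace hX Xt
    ((readoutSpace p X hX).starProjection_apply_mem (hy.toLp y))
  have hsplit : hy.toLp y = ∑ i, c i • (Xt i : Lp ℝ 2 p) + orthComponent p X y hX hy := by
    rw [← hc]
    exact ((readoutSpace p X hX).starProjection_add_starProjection_orthogonal _).symm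
  refine ⟨c, ?_⟩
  filter_upwards [hy.coeFn_toLp, coeFn_sum_smul_ae c fun i => (Xt i : Lp ℝ 2 p),
    Lp.coeFn_add (∑ i, c i • (Xt i : Lp ℝ 2 p)) (orthComponent p X y hX hy)] with a hya hsum hadd
  rw [← hya, hsplit, hadd, Pi.add_apply, hsum]

theorem exists_isOrthonormalDecomposition [DecidableEq ι] (hy : MemLp y 2 p) :
    ∃ A B c, IsOrthonormalDecomposition p X y (fun i => (Xt i : Lp ℝ 2 p))
      (orthComponent p X y hX hy) A B c := by
  choose A hA using exists_readout_eq_ae hX Xt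
  choose B hB using exists_basis_eq_ae hX Xt
  obtain ⟨c, hc⟩ := exists_target_eq_ae hX Xt hy
  refine ⟨A, B, c, fun i j => ?_, fun i => ?_, hA, hB, hc⟩
  · rw [integral_coeFn_mul, ← Submodule.coe_inner, Matrix.one_apply]
    exact orthonormal_iff_ite.1 Xt.orthonormal i j
  · rw [integral_coeFn_mul]
    exact Submodule.inner_right_of_mem_orthogonal (Xt i).2 (Submodule.starProjection_apply_mem _ _)

end L2

section Bias

variable {U ι : Type*} [MeasurableSpace U] [Fintype ι] {p : Measure U} {K : ℕ}
  {X : Fin K → U → ℝ} {y : U → ℝ} {hX : ∀ i, MemLp (X i) 2 p} {hy : MemLp y 2 p}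
  {Xt : OrthonormalBasis ι ℝ (readoutSpace p X hX)}

theorem biasIntegrand_eq_sum : biasIntegrand p X y hX hy Xt
    = fun a => ∑ i, ((Xt i : Lp ℝ 2 p) a * orthComponent p X y hX hy a) ^ 2 := by
  simp only [funext_iff, biasIntegrand, mul_pow, Finset.sum_mul, implies_true]

theorem integrable_biasIntegrand
    (h : ∀ i, MemLp (fun a => (Xt i : Lp ℝ 2 p) a * orthComponent p X y hX hy a) 2 p) :
    Integrable (biasIntegrand p X y hX hy Xt) p := by
  rw [biasIntegrand_eq_sum]
  exact integrable_finsetSum _ fun i _ => (h i).integrable_sq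

theorem integral_biasIntegrand
    (h : ∀ i, MemLp (fun a => (Xt i : Lp ℝ 2 p) a * orthComponent p X y hX hy a) 2 p) :
    ∫ a, biasIntegrand p X y hX hy Xt a ∂p
      = ∑ i, ∫ a, ((Xt i : Lp ℝ 2 p) a * orthComponent p X y hX hy a) ^ 2 ∂p := by
  rw [biasIntegrand_eq_sum]
  exact integral_finsetSum _ fun i _ => (h i).integrable_sq

theorem biasCoeff_nonneg : 0 ≤ biasCoeff p X y hX hy Xt :=
  div_nonneg (integral_nonneg fun _ => mul_nonneg (Finset.sum_nonneg fun _ _ => sq_nonneg _)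
    (sq_nonneg _)) (integral_nonneg fun a => sq_nonneg (y a))

end Bias

end IPC

theorem proposition7 {U : Type*} [MeasurableSpace U] (p : Measure U) [IsProbabilityMeasure p]
    {K : ℕ} (X : Fin K → U → ℝ) (y : U → ℝ)
    (hX : ∀ i, MemLp (X i) 2 p) (hy : MemLp y 2 p) (hy0 : 0 < ∫ v, y v ^ 2 ∂p)
    (hX5 : ∀ i, MemLp (X i) 5 p) (hy5 : MemLp y 5 p)
    {ι : Type*} [Fintype ι] (Xt : OrthonormalBasis ι ℝ (IPC.readoutSpace p X hX))
    {Ω : Type*} [MeasurableSpace Ω] (P : Measure Ω) [IsProbabilityMeasure P]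
    (u : ℕ → Ω → U) (hu : ∀ n, HasLaw (u n) p P) (hind : iIndepFun u P) :
    (∀ N : ℕ, Integrable (fun ω => IPC.empCapacity p X y (fun n : Fin N => u n ω)) P) ∧
    Integrable (IPC.biasIntegrand p X y hX hy Xt) p ∧
    0 ≤ IPC.biasCoeff p X y hX hy Xt ∧
    (fun N : ℕ => (∫ ω, IPC.empCapacity p X y (fun n : Fin N => u n ω) ∂P)
        - (IPC.capacity p X y + IPC.biasCoeff p X y hX hy Xt / (N : ℝ)))
      =O[atTop] (fun N : ℕ => (N : ℝ) ^ (-(3 / 2) : ℝ)) := by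
  classical
  obtain ⟨A, B, c, h⟩ := IPC.exists_isOrthonormalDecomposition hX Xt hy
  have hprod := fun i => IPC.memLp_two_of_memLp_five_halves <|
    IPC.memLp_pairProduct (h.memLp_basis hX5) (h.memLp_residual hX5 hy5) (.inr (.inl i))
  refine ⟨fun N => (IPC.integrable_explainedPower_sample hu hX hy N).div_const _,
    IPC.integrable_biasIntegrand hprod, IPC.biasCoeff_nonneg, ?_⟩
  rw [IPC.biasCoeff, IPC.integral_biasIntegrand hprod]
  exact h.isBigO_integral_empCapacity_sub hX5 hy5 hy0.ne' hu hind
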